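/- A subharmonic function on $\mathbb{C}$ is an upper semicontinuous function $u:\mathbb{C}\to[-\infty,\infty)$, not identically $-\infty$, such that $u(z)\le \frac1{2\pi}\int_0^{2\pi}u(z+re^{i\theta})\,d\theta$ for all $z\in\mathbb{C}$ and $r>0$. It is said to be of logarithmic growth if its logarithmic type $$\sigma_u:=\limsup_{|z|\to\infty}\frac{u(z)}{\log|z|}$$ is $<+\infty$. For a function $g:\mathbb{C}\to[0,\infty]$, write $g\in L^2(\infty)$ if $g$ is measurable and there is a compact set $K\subset\mathbb{C}$ such that $\int_{\mathbb{C}\setminus K}g^2<\infty$ (integral with respect to Lebesgue measure). Set $u^+:=\max\{u,0\}$ and $$c_\infty(u):=\inf\{c>0:\ e^{-cu}\in L^2(\infty)\},\qquad \hat c_\infty(u):=c_\infty(u^+),$$ with values in $[0,+\infty]$, where $\inf\emptyset=+\infty$ and $e^{-cu}=+\infty$ where $u=-\infty$. **Theorem.** Let $u$ be a subharmonic function of logarithmic growth on $\mathbb{C}$. Then $0\le\sigma_u<\infty$ and $$c_\infty(u)=\hat c_\infty(u)=\frac1{\sigma_u},$$ where $1/0:=+\infty$. If moreover $u$ is nonconstant,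 then $\sigma_u>0$ and $$\{c>0:\ e^{-cu}\in L^2(\infty)\}=\{c>0:\ e^{-cu^+}\in L^2(\infty)\}=\left(\frac1{\sigma_u},+\infty\right).$$ -/

import Mathlib

open MeasureTheory Filter
open scoped ENNReal

noncomputable section

/-- The mean of an extended-real function `u` over the circle with centre `z` and radius `r`:
`(1 / 2π) (∫ u⁺ - ∫ u⁻)`, with values in `[-∞, ∞]`. If `u` is upper semicontinuous and `< ∞`,
then `u⁺` is bounded on the circle, so that no indeterminate difference `∞ - ∞` occurs. -/
def circleMean (u : ℂ → EReal) (z : ℂ) (r : ℝ) : EReal :=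
  (((2 * Real.pi)⁻¹ : ℝ) : EReal) *
    (((∫⁻ θ in Set.Ioc (0 : ℝ) (2 * Real.pi), (u (circleMap z r θ)).toENNReal : ℝ≥0∞) : EReal) -
      ((∫⁻ θ in Set.Ioc (0 : ℝ) (2 * Real.pi), (-u (circleMap z r θ)).toENNReal : ℝ≥0∞) : EReal))

/-- Subharmonic functions `u : ℂ → [-∞, ∞)`: upper semicontinuous, not identically `-∞`, and
satisfying the sub-mean value inequality on all circles. -/
structure IsSubharmonic (u : ℂ → EReal) : Prop where
  lt_top : ∀ z, u z < ⊤
  upperSemicontinuous : UpperSemicontinuous u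
  ne_bot : ∃ z, u z ≠ ⊥
  le_circleMean : ∀ (z : ℂ) (r : ℝ), 0 < r → u z ≤ circleMean u z r

/-- The logarithmic type `σ_u = limsup_{z → ∞} u z / log |z|`, with values in `[-∞, ∞]`. -/
def logType (u : ℂ → EReal) : EReal :=
  limsup (fun z : ℂ => u z / ((Real.log ‖z‖ : ℝ) : EReal)) (Bornology.cobounded ℂ)

/-- Subharmonic functions of logarithmic growth in the complex plane. -/
structure IsLogSubharmonic (u : ℂ → EReal) : Prop where
  isSubharmonic : IsSubharmonic u
  logType_lt_top : logType u < ⊤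

/-- The function `e^{-cu}` with values in `[0, ∞]`; for `c > 0` it is `∞` where `u = -∞`. -/
def expNegMul (c : ℝ) (u : ℂ → EReal) (z : ℂ) : ℝ≥0∞ := EReal.exp (-((c : EReal) * u z))

/-- `g ∈ L²(∞)`: the function `g ≥ 0` is square-integrable outside some compact set. -/
def IsL2AtInfty (g : ℂ → ℝ≥0∞) : Prop :=
  AEMeasurable g ∧ ∃ K : Set ℂ, IsCompact K ∧ ∫⁻ z in Kᶜ, g z ^ 2 < ⊤

/-- The set of all `c > 0` such that `e^{-cu} ∈ L²(∞)`. -/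
def integrabilitySet (u : ℂ → EReal) : Set ℝ :=
  {c : ℝ | 0 < c ∧ IsL2AtInfty (expNegMul c u)}

/-- The log canonical threshold at infinity, `inf {c > 0 : e^{-cu} ∈ L²(∞)}`, with values in
`[0, ∞]`; the infimum of the empty set is `∞`. -/
def lctAtInfty (u : ℂ → EReal) : ℝ≥0∞ := sInf (ENNReal.ofReal '' integrabilitySet u)

/-- The positive part `u⁺ = max {u, 0}`. -/
def positivePart (u : ℂ → EReal) (z : ℂ) : EReal := max (u z) 0

/-- The threshold `ĉ_∞(u) = c_∞(u⁺)`. -/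
def lctHatAtInfty (u : ℂ → EReal) : ℝ≥0∞ := lctAtInfty (positivePart u)

end

/-! The growth of `u` is governed by convexity. The three circles theorem turns the limsup `σ` into
the bound `u ≤ A + σ log⁺|z|`, so for `cσ ≤ 1` both `e^{-2cu}` and `e^{-2cu⁺}` dominate a multiple
of `|z|⁻²` near infinity, which is not integrable (`not_isL2AtInfty_expNegMul`). If `σ ≤ 0`, the
same theorem around an arbitrary centre gives Liouville's theorem, and `u` is constant.

For `c > 1/σ`, put `t = 2c`. Convexity also yields, on every large circle, a point where `u ≥ (σ -
δ) log S`; comparing area means upgrades this to a lower bound `(σ - 25δ) log S - O(1)` for all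
means over circles of radius `S` centred in `|z| ≤ 3S`. The growth of the means about `0` then
forces the Riesz mass of large discs to be `σ` up to `O(δ)`, so that distant annuli `S ≤ |z| < 4S`
carry little mass (`mass_annulus_le`). On `2S ≤ |z| ≤ 3S` the function is its circle mean minus a
logarithmic potential of that small mass. Jensen's inequality bounds the exponential of the
potential by an average of `max(1, S/|z-w|)`, which is integrable in `z`. Each annulus thus
contributes `O(S^{2 - t(σ-25δ)})`, and the sum over a geometric sequence of radii converges because
`tσ > 2`.

The Riesz measure is needed only for smoothed functions. Averaging a continuous subharmonic `w`
against `log⁺(h/|y|)` gives a function whose Riesz density is explicit, a multiple of (mean of `w`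
over the circle of radius `h`) minus `w`. A general `u` is first made continuous by a tent kernel.
Both smoothings dominate `u` and keep the growth constants uniform, so Fatou's lemma carries the
estimate back to `u`. -/

/-! ### The logarithmic kernel and its integrability. -/

open Real Metric Topology in
theorem circleAverage_log_norm_eq {L : ℝ} (hL : 0 < L) {y : ℂ} (hy : y ≠ 0) :
    circleAverage (fun x => log ‖x‖) y L = log ‖y‖ + posLog (L / ‖y‖) := by
  have h := circleAverage_log_norm_sub_const_eq_log_radius_add_posLog (c := y) (a := 0) hL.ne'
  simp only [sub_zero] at h
  rw [h, show L / ‖y‖ = (L⁻¹ * ‖y‖)⁻¹ by rw [mul_inv, inv_inv]; rfl]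
  have h2 := posLog_sub_posLog_inv (x := L⁻¹ * ‖y‖)
  rw [Real.log_mul (by positivity) (by simpa using hy), Real.log_inv] at h2
  linarith

/-- The fundamental kernel `log⁺ (L / |y|)` of the disc of radius `L`. -/
noncomputable def logKernel (L : ℝ) (y : ℂ) : ℝ := Real.posLog (L / ‖y‖)

theorem logKernel_nonneg (L : ℝ) (y : ℂ) : 0 ≤ logKernel L y := Real.posLog_nonneg

theorem logKernel_eq_zero {L : ℝ} (hL : 0 ≤ L) {y : ℂ} (hy : L ≤ ‖y‖) : logKernel L y = 0 := by
  rw [logKernel, Real.posLog_eq_zero_iff, abs_of_nonneg (by positivity)]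
  exact div_le_one_of_le₀ hy (norm_nonneg y)

theorem measurable_logKernel (L : ℝ) : Measurable (logKernel L) := by
  unfold logKernel
  exact Real.continuous_posLog.measurable.comp (by fun_prop)

theorem lintegral_ball_inv_norm {L : ℝ} (hL : 0 ≤ L) :
    ∫⁻ y in Metric.ball (0 : ℂ) L, ENNReal.ofReal (‖y‖⁻¹) = ENNReal.ofReal (2 * Real.pi * L) := by
  rw [← lintegral_indicator Metric.isOpen_ball.measurableSet,
    ← Complex.lintegral_comp_polarCoord_symm]
  have h1 : ∀ p ∈ polarCoord.target, ENNReal.ofReal p.1 •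
      (Metric.ball (0 : ℂ) L).indicator (fun y => ENNReal.ofReal (‖y‖⁻¹))
        (Complex.polarCoord.symm p) =
      (Set.Ioo 0 L ×ˢ Set.Ioo (-Real.pi) Real.pi).indicator (fun _ => (1 : ℝ≥0∞)) p := by
    rintro ⟨r, θ⟩ hp
    simp only [polarCoord_target, Set.mem_prod, Set.mem_Ioi] at hp
    have hn : ‖Complex.polarCoord.symm (r, θ)‖ = r := by
      rw [Complex.norm_polarCoord_symm, abs_of_pos hp.1]
    by_cases hr : r < L
    · rw [Set.indicator_of_mem (by simpa [hn, abs_of_pos hp.1] using hr), Set.indicator_of_mem (by simp_all), hn,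
        smul_eq_mul, ← ENNReal.ofReal_mul hp.1.le, mul_inv_cancel₀ hp.1.ne', ENNReal.ofReal_one]
    · rw [Set.indicator_of_notMem (by simpa [hn, abs_of_pos hp.1] using hr), Set.indicator_of_notMem (by simp_all),
        smul_zero]
  rw [setLIntegral_congr_fun (by measurability) h1, setLIntegral_indicator (by measurability),
    setLIntegral_one, polarCoord_target, Set.inter_eq_left.2
      (Set.prod_mono (fun x hx => hx.1) subset_rfl), Measure.volume_eq_prod, Measure.prod_prod,
      Real.volume_Ioo, Real.volume_Ioo, ← ENNReal.ofReal_mul (by linarith)]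
  congr 1; ring

theorem integrableOn_ball_inv_norm (L : ℝ) :
    IntegrableOn (fun y : ℂ => ‖y‖⁻¹) (Metric.ball 0 L) := by
  rcases le_total 0 L with hL | hL
  · refine ⟨by fun_prop, ?_⟩
    rw [hasFiniteIntegral_iff_ofReal (ae_of_all _ fun y => by positivity),
      lintegral_ball_inv_norm hL]
    exact ENNReal.ofReal_lt_top
  · rw [Metric.ball_eq_empty.2 hL]; exact integrableOn_empty

theorem locallyIntegrable_log_norm : LocallyIntegrable (fun y : ℂ => Real.log ‖y‖) := by
  intro x
  refine ⟨Metric.ball 0 (‖x‖ + 1), Metric.isOpen_ball.mem_nhds (by simp), ?_⟩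
  refine Integrable.mono' ((integrableOn_ball_inv_norm (‖x‖ + 1)).add
    (integrableOn_const (C := ‖x‖ + 1) (by finiteness)))
    (Real.measurable_log.comp measurable_norm).aestronglyMeasurable ?_
  refine (ae_restrict_iff' Metric.isOpen_ball.measurableSet).2 (ae_of_all _ fun y hy => ?_)
  have hy' : ‖y‖ < ‖x‖ + 1 := by simpa using hy
  simp only [Pi.add_apply, Real.norm_eq_abs]
  rcases eq_or_ne y 0 with rfl | h0
  · simp; positivity
  have hp := norm_pos_iff.2 h0
  have h1 := Real.log_le_sub_one_of_pos hp
  have h2 := Real.log_le_sub_one_of_pos (inv_pos.2 hp)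
  rw [Real.log_inv] at h2
  have h3 := inv_pos.2 hp
  rw [abs_le]; constructor <;> linarith

theorem integrable_logKernel {L : ℝ} (hL : 0 ≤ L) : Integrable (logKernel L) := by
  have : IntegrableOn (logKernel L) (Metric.ball 0 L) := by
    refine Integrable.mono' ((integrableOn_ball_inv_norm L).const_mul L)
      (measurable_logKernel L).aestronglyMeasurable (ae_of_all _ fun y => ?_)
    rw [Real.norm_of_nonneg (logKernel_nonneg L y), logKernel, Real.posLog, ← div_eq_mul_inv]
    refine max_le (by positivity) (Real.log_le_self (by positivity))
  rw [← integrable_indicator_iff Metric.isOpen_ball.measurableSet] at this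
  refine this.congr (ae_of_all _ fun y => ?_)
  by_cases hy : y ∈ Metric.ball 0 L
  · simp [hy]
  · simp only [hy, not_false_eq_true, Set.indicator_of_notMem]
    exact (logKernel_eq_zero hL (by simpa using hy)).symm

/-! ### Circle averages of convolutions and of logarithmic potentials. -/

theorem circleMap_sub_const (z y : ℂ) (L θ : ℝ) : circleMap z L θ - y = circleMap (z - y) L θ := by
  simp only [circleMap]; ring

theorem integrable_kernel_mul_circleMap {k : ℂ → ℝ} (hk : LocallyIntegrable k) {W : ℂ → ℝ}
    (hW : Continuous W) (hWc : HasCompactSupport W) (z : ℂ) (L : ℝ) :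
    Integrable (fun p : ℝ × ℂ => k p.2 * W (circleMap z L p.1 - p.2))
      ((volume.restrict (Set.Ioc 0 (2 * Real.pi))).prod volume) := by
  obtain ⟨C, hC⟩ := hWc.exists_bound_of_continuous hW
  obtain ⟨R, hR⟩ := hWc.isCompact.isBounded.subset_closedBall 0
  have hi : Integrable ((Metric.closedBall 0 (‖z‖ + |L| + R)).indicator fun y => ‖k y‖ * C) := by
    rw [integrable_indicator_iff Metric.isClosed_closedBall.measurableSet]
    exact (hk.integrableOn_isCompact (isCompact_closedBall _ _)).norm.mul_const C
  refine Integrable.mono' (hi.comp_snd _) ?_ (ae_of_all _ fun p => ?_)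
  · refine AEStronglyMeasurable.mul hk.aestronglyMeasurable.comp_snd ?_
    exact (hW.comp (by unfold circleMap; fun_prop)).aestronglyMeasurable
  · by_cases hp : W (circleMap z L p.1 - p.2) = 0
    · rw [hp, mul_zero, norm_zero]
      exact Set.indicator_nonneg (fun y _ => mul_nonneg (norm_nonneg _)
        ((norm_nonneg _).trans (hC 0))) _
    · have h1 := hR (subset_tsupport _ hp)
      rw [mem_closedBall_zero_iff] at h1
      rw [Set.indicator_of_mem, norm_mul]
      · exact mul_le_mul_of_nonneg_left (hC _) (norm_nonneg _)
      · rw [mem_closedBall_zero_iff]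
        have h2 : ‖circleMap z L p.1‖ ≤ ‖z‖ + |L| := by
          unfold circleMap
          refine (norm_add_le _ _).trans ?_
          simp
        calc ‖p.2‖ = ‖circleMap z L p.1 - (circleMap z L p.1 - p.2)‖ := by congr 1; ring
          _ ≤ _ := (norm_sub_le _ _).trans (by linarith)

theorem circleAverage_eq_setIntegral (f : ℂ → ℝ) (z : ℂ) (L : ℝ) :
    Real.circleAverage f z L =
      (2 * Real.pi)⁻¹ * ∫ θ in Set.Ioc 0 (2 * Real.pi), f (circleMap z L θ) := by
  rw [Real.circleAverage_def, intervalIntegral.integral_of_le Real.two_pi_pos.le, smul_eq_mul]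

/-- Convolution of a locally integrable kernel with a compactly supported function commutes with
circle averages. -/
theorem circleAverage_convolution {k : ℂ → ℝ} (hk : LocallyIntegrable k) {W : ℂ → ℝ}
    (hW : Continuous W) (hWc : HasCompactSupport W) (z : ℂ) (L : ℝ) :
    Real.circleAverage (fun x => ∫ y, k y * W (x - y)) z L =
      ∫ y, k y * Real.circleAverage W (z - y) L := by
  rw [circleAverage_eq_setIntegral,
    integral_integral_swap (integrable_kernel_mul_circleMap hk hW hWc z L), ← integral_const_mul]
  refine integral_congr_ae (ae_of_all _ fun y => ?_)
  simp only [circleAverage_eq_setIntegral, integral_const_mul, circleMap_sub_const]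
  ring

/-- For each angle the reflection `y ↦ circleMap z L θ - y` reduces this to
`integrable_kernel_mul_circleMap`; the two halves of the Tonelli criterion are transported
separately. -/
theorem integrable_kernel_circleMap_mul {k : ℂ → ℝ} (hkm : Measurable k)
    (hk : LocallyIntegrable k) {W : ℂ → ℝ} (hW : Continuous W) (hWc : HasCompactSupport W) (z : ℂ)
    (L : ℝ) :
    Integrable (fun p : ℝ × ℂ => k (circleMap z L p.1 - p.2) * W p.2)
      ((volume.restrict (Set.Ioc 0 (2 * Real.pi))).prod volume) := by
  have hi := integrable_kernel_mul_circleMap hk hW hWc z L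
  have hm : AEStronglyMeasurable (fun p : ℝ × ℂ => k (circleMap z L p.1 - p.2) * W p.2)
      ((volume.restrict (Set.Ioc 0 (2 * Real.pi))).prod volume) := by
    refine Measurable.aestronglyMeasurable (Measurable.mul (hkm.comp ?_) ?_)
    · exact Continuous.measurable (by unfold circleMap; fun_prop)
    · exact hW.measurable.comp measurable_snd
  rw [integrable_prod_iff hm]
  constructor
  · filter_upwards [hi.prod_right_ae] with θ hθ
    refine (hθ.comp_sub_left (circleMap z L θ)).congr (ae_of_all _ fun y => ?_)
    simp
  · refine hi.integral_norm_prod_left.congr (ae_of_all _ fun θ => ?_)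
    simp only
    rw [← integral_sub_left_eq_self _ _ (circleMap z L θ)]
    simp

theorem circleAverage_mul_eq (k W : ℂ → ℝ) (z : ℂ) (L : ℝ) (y : ℂ) :
    Real.circleAverage k (z - y) L * W y = (2 * Real.pi)⁻¹ *
      ∫ θ in Set.Ioc 0 (2 * Real.pi), k (circleMap z L θ - y) * W y := by
  simp only [circleAverage_eq_setIntegral, integral_mul_const, circleMap_sub_const]
  ring

theorem integrable_circleAverage_mul {k : ℂ → ℝ} (hkm : Measurable k)
    (hk : LocallyIntegrable k) {W : ℂ → ℝ} (hW : Continuous W) (hWc : HasCompactSupport W) (z : ℂ)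
    (L : ℝ) : Integrable fun y => Real.circleAverage k (z - y) L * W y := by
  simp only [circleAverage_mul_eq]
  exact (integrable_kernel_circleMap_mul hkm hk hW hWc z L).integral_prod_right.const_mul _

theorem circleAverage_convolution' {k : ℂ → ℝ} (hkm : Measurable k) (hk : LocallyIntegrable k)
    {W : ℂ → ℝ} (hW : Continuous W) (hWc : HasCompactSupport W) (z : ℂ) (L : ℝ) :
    Real.circleAverage (fun x => ∫ y, k y * W (x - y)) z L =
      ∫ y, Real.circleAverage k (z - y) L * W y := by
  have h1 : (fun x => ∫ y, k y * W (x - y)) = fun x => ∫ y, k (x - y) * W y := by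
    ext x; rw [← integral_sub_left_eq_self _ _ x]; simp
  rw [h1, circleAverage_eq_setIntegral,
    integral_integral_swap (integrable_kernel_circleMap_mul hkm hk hW hWc z L),
    ← integral_const_mul]
  simp only [circleAverage_mul_eq]

/-- The potential `∫ log⁺ (L / |y|) w (z - y) dy`. -/
noncomputable def logPot (L : ℝ) (w : ℂ → ℝ) (z : ℂ) : ℝ := ∫ y, logKernel L y * w (z - y)

theorem integrable_kernel_mul {k : ℂ → ℝ} (hk : LocallyIntegrable k) {W : ℂ → ℝ}
    (hW : Continuous W) (hWc : HasCompactSupport W) (z : ℂ) :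
    Integrable (fun y => k y * W (z - y)) := by
  have h1 : Continuous fun y => W (z - y) := by fun_prop
  have h2 : HasCompactSupport fun y => W (z - y) := hWc.comp_homeomorph (Homeomorph.subLeft z)
  exact hk.integrable_smul_right_of_hasCompactSupport h1 h2

theorem continuous_circleAverage {w : ℂ → ℝ} (hw : Continuous w) (h : ℝ) :
    Continuous (fun z => Real.circleAverage w z h) := by
  simp only [Real.circleAverage_def]
  have h1 : Continuous fun z => ∫ θ in (0 : ℝ)..2 * Real.pi, w (circleMap z h θ) := by
    refine intervalIntegral.continuous_parametric_intervalIntegral_of_continuous' ?_ _ _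
    exact hw.comp (by unfold circleMap; fun_prop)
  exact h1.const_smul (2 * Real.pi)⁻¹

theorem hasCompactSupport_circleAverage {w : ℂ → ℝ} (hw : HasCompactSupport w) (h : ℝ) :
    HasCompactSupport (fun z => Real.circleAverage w z h) := by
  obtain ⟨R, hR⟩ := hw.isCompact.isBounded.subset_closedBall 0
  refine HasCompactSupport.intro (isCompact_closedBall (0 : ℂ) (R + |h|)) fun z hz => ?_
  have : Set.EqOn w (fun _ => 0) (Metric.sphere z |h|) := by
    intro x hx
    by_contra h0
    have h1 := hR (subset_tsupport _ h0)
    simp only [mem_closedBall_zero_iff, not_le, mem_sphere_iff_norm] at hz h1 hx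
    have : ‖z‖ ≤ ‖x‖ + ‖x - z‖ := by
      calc ‖z‖ = ‖x - (x - z)‖ := by congr 1; ring
        _ ≤ _ := norm_sub_le _ _
    linarith
  rw [Real.circleAverage_congr_sphere this, Real.circleAverage_const]

/-- Fubini moves the average onto `log ‖·‖`, where Jensen's formula evaluates it: the excess over
the value at the centre is exactly `logKernel L`. -/
theorem circleAverage_newtonian {W : ℂ → ℝ} (hW : Continuous W) (hWc : HasCompactSupport W)
    {L : ℝ} (hL : 0 < L) (z : ℂ) :
    Real.circleAverage (fun x => ∫ y, Real.log ‖y‖ * W (x - y)) z L =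
      (∫ y, Real.log ‖y‖ * W (z - y)) + logPot L W z := by
  rw [circleAverage_convolution' (by fun_prop) locallyIntegrable_log_norm hW hWc, logPot,
    ← integral_add (integrable_kernel_mul locallyIntegrable_log_norm hW hWc z)
      (integrable_kernel_mul (integrable_logKernel hL.le).locallyIntegrable hW hWc z),
    ← integral_sub_left_eq_self _ _ z]
  refine integral_congr_ae ?_
  have h0 : ∀ᵐ y : ℂ, y ≠ 0 := by simp [ae_iff]
  filter_upwards [h0] with y hy
  rw [sub_sub_cancel, circleAverage_log_norm_eq hL hy, logKernel]
  ring

/-- The mean of a Newtonian potential is computed in two ways, with the average falling on the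
kernel or on `W`. This is the integrated form of the fact that the Laplacian of `log⁺(h/|y|)` is, up
to `2π`, the uniform measure of the circle minus the point mass at `0`. -/
theorem logPot_eq_newtonian {W : ℂ → ℝ} (hW : Continuous W) (hWc : HasCompactSupport W)
    {h : ℝ} (hh : 0 < h) (z : ℂ) :
    logPot h W z = ∫ y, Real.log ‖y‖ * (Real.circleAverage W (z - y) h - W (z - y)) := by
  have h1 := circleAverage_newtonian hW hWc hh z
  rw [circleAverage_convolution locallyIntegrable_log_norm hW hWc] at h1
  simp only [mul_sub]
  rw [integral_sub (integrable_kernel_mul locallyIntegrable_log_norm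
      (continuous_circleAverage hW h) (hasCompactSupport_circleAverage hWc h) z)
      (integrable_kernel_mul locallyIntegrable_log_norm hW hWc z), h1]
  ring

theorem circleAverage_logPot_of_hasCompactSupport {W : ℂ → ℝ} (hW : Continuous W)
    (hWc : HasCompactSupport W) {h L : ℝ} (hh : 0 < h) (hL : 0 < L) (z : ℂ) :
    Real.circleAverage (logPot h W) z L =
      logPot h W z + logPot L (fun x => Real.circleAverage W x h - W x) z := by
  have h1 : logPot h W = fun z => ∫ y, Real.log ‖y‖ *
      (fun x => Real.circleAverage W x h - W x) (z - y) :=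
    funext fun z => logPot_eq_newtonian hW hWc hh z
  rw [h1]
  exact circleAverage_newtonian ((continuous_circleAverage hW h).sub hW)
    ((hasCompactSupport_circleAverage hWc h).sub hWc) hL z

/-- Newtonian potentials need compact support, whereas `logPot` and circle averages at a point see
only a bounded region; truncation removes the support hypothesis. -/
theorem exists_cutoff {w : ℂ → ℝ} (hw : Continuous w) (z : ℂ) (R : ℝ) :
    ∃ W : ℂ → ℝ, Continuous W ∧ HasCompactSupport W ∧ Set.EqOn W w (Metric.closedBall z R) := by
  refine ⟨fun y => max 0 (min 1 (R + 1 - ‖y - z‖)) * w y, by fun_prop, ?_, fun y hy => ?_⟩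
  · refine HasCompactSupport.intro (isCompact_closedBall z (R + 1)) fun y hy => ?_
    simp only [mem_closedBall_iff_norm, not_le] at hy
    rw [max_eq_left ((min_le_right _ _).trans (by linarith)), zero_mul]
  · rw [mem_closedBall_iff_norm] at hy
    simp only
    rw [min_eq_left (by linarith), max_eq_right zero_le_one, one_mul]

theorem logPot_congr {L : ℝ} (hL : 0 ≤ L) {w W : ℂ → ℝ} {z : ℂ}
    (h : Set.EqOn W w (Metric.ball z L)) : logPot L W z = logPot L w z := by
  refine integral_congr_ae (ae_of_all _ fun y => ?_)
  simp only
  rcases lt_or_ge ‖y‖ L with hy | hy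
  · rw [h (by simpa [dist_eq_norm] using hy)]
  · rw [logKernel_eq_zero hL hy, zero_mul, zero_mul]

theorem circleAverage_logPot {w : ℂ → ℝ} (hw : Continuous w) {h L : ℝ} (hh : 0 < h) (hL : 0 < L)
    (z : ℂ) :
    Real.circleAverage (logPot h w) z L =
      logPot h w z + logPot L (fun x => Real.circleAverage w x h - w x) z := by
  obtain ⟨W, hW, hWc, hWw⟩ := exists_cutoff hw z (h + L)
  have key := circleAverage_logPot_of_hasCompactSupport hW hWc hh hL z
  have e1 : ∀ x ∈ Metric.closedBall z L, logPot h W x = logPot h w x := fun x hx =>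
    logPot_congr hh.le (hWw.mono (Metric.ball_subset_closedBall.trans
      (Metric.closedBall_subset_closedBall' (by
        rw [Metric.mem_closedBall] at hx; linarith))))
  have e2 : Set.EqOn (fun x => Real.circleAverage W x h - W x)
      (fun x => Real.circleAverage w x h - w x) (Metric.ball z L) := by
    intro x hx
    rw [Metric.mem_ball] at hx
    simp only
    rw [hWw (by rw [Metric.mem_closedBall]; linarith), Real.circleAverage_congr_sphere
      (hWw.mono (Metric.sphere_subset_closedBall.trans
      (Metric.closedBall_subset_closedBall' (by rw [abs_of_pos hh]; linarith))))]
  rw [logPot_congr hL.le e2, e1 z (by simp [hL.le]), Real.circleAverage_congr_sphere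
    (f₂ := logPot h w) (fun x hx => e1 x (Metric.sphere_subset_closedBall
      (by rwa [abs_of_pos hL] at hx)))] at key
  exact key

theorem continuous_logPot {w : ℂ → ℝ} (hw : Continuous w) {h : ℝ} (hh : 0 ≤ h) :
    Continuous (logPot h w) := by
  rw [continuous_iff_continuousAt]
  intro z
  obtain ⟨W, hW, hWc, hWw⟩ := exists_cutoff hw z (h + 1)
  have hc : Continuous (logPot h W) := by
    have := hWc.continuous_convolution_right (ContinuousLinearMap.mul ℝ ℝ) (μ := volume)
      (integrable_logKernel hh).locallyIntegrable hW
    exact this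
  refine hc.continuousAt.congr ?_
  filter_upwards [Metric.ball_mem_nhds z one_pos] with x hx
  refine logPot_congr hh (hWw.mono (Metric.ball_subset_closedBall.trans
      (Metric.closedBall_subset_closedBall' (by rw [Metric.mem_ball] at hx; linarith))))

/-! ### Radial averages in polar coordinates. -/

theorem setIntegral_circleMap_Ioo (g : ℂ → ℝ) (z : ℂ) (r : ℝ) :
    ∫ θ in Set.Ioo (-Real.pi) Real.pi, g (circleMap z r θ) =
      2 * Real.pi * Real.circleAverage g z r := by
  have hp : Function.Periodic (fun θ => g (circleMap z r θ)) (2 * Real.pi) :=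
    (periodic_circleMap z r).comp g
  have := hp.intervalIntegral_add_eq (-Real.pi) 0
  rw [show -Real.pi + 2 * Real.pi = Real.pi by ring, zero_add] at this
  rw [← integral_Ioc_eq_integral_Ioo,
    ← intervalIntegral.integral_of_le (by linarith [Real.pi_pos]), this, Real.circleAverage_def,
    smul_eq_mul, mul_inv_cancel_left₀ Real.two_pi_pos.ne']

theorem integral_radial_mul_nonneg {k : ℝ → ℝ} (hk : ∀ r > 0, 0 ≤ k r) {g : ℂ → ℝ}
    (hg : ∀ r > 0, k r ≠ 0 → 0 ≤ Real.circleAverage g 0 r) : 0 ≤ ∫ y : ℂ, k ‖y‖ * g y := by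
  rw [← Complex.integral_comp_polarCoord_symm]
  have h1 : ∀ p ∈ polarCoord.target,
      p.1 • (k ‖Complex.polarCoord.symm p‖ * g (Complex.polarCoord.symm p)) =
      p.1 * k p.1 * g (circleMap 0 p.1 p.2) := by
    rintro ⟨r, θ⟩ hp
    simp only [polarCoord_target, Set.mem_prod, Set.mem_Ioi] at hp
    rw [Complex.norm_polarCoord_symm, abs_of_pos hp.1, smul_eq_mul, mul_assoc]
    congr 3
    simp [circleMap, Complex.polarCoord_symm_apply, Complex.exp_mul_I]
  rw [setIntegral_congr_fun polarCoord.open_target.measurableSet h1, polarCoord_target]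
  by_cases hi : IntegrableOn (fun p : ℝ × ℝ => p.1 * k p.1 * g (circleMap 0 p.1 p.2))
      (Set.Ioi 0 ×ˢ Set.Ioo (-Real.pi) Real.pi)
  · rw [Measure.volume_eq_prod] at hi ⊢
    rw [setIntegral_prod _ hi]
    refine setIntegral_nonneg measurableSet_Ioi fun r hr => ?_
    simp only [integral_const_mul, setIntegral_circleMap_Ioo]
    rcases eq_or_ne (k r) 0 with h0 | h0
    · simp [h0]
    · have h2 := hg r hr h0
      have h3 := hk r hr
      have h4 : (0 : ℝ) < r := hr
      have := Real.pi_pos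
      positivity
  -- A non-integrable function has integral `0` by convention, so the inequality survives.
  · rw [integral_undef hi]

/-- A radial kernel is a superposition of circles about the centre, so bounds on circle averages
integrate. Only radii where `k` is nonzero matter; this later localizes the hypothesis to a disc. -/
theorem const_mul_integral_radial_le {k : ℝ → ℝ} (hk : ∀ r > 0, 0 ≤ k r)
    (hki : Integrable fun y : ℂ => k ‖y‖) {f : ℂ → ℝ} {z : ℂ}
    (hf : Integrable fun y => k ‖y‖ * f (z - y)) {b : ℝ}
    (hb : ∀ r > 0, k r ≠ 0 → CircleIntegrable f z r ∧ b ≤ Real.circleAverage f z r) :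
    b * ∫ y : ℂ, k ‖y‖ ≤ ∫ y, k ‖y‖ * f (z - y) := by
  have hf' : Integrable fun y => k ‖y‖ * f (y + z) := by
    refine hf.comp_neg.congr (ae_of_all _ fun y => ?_)
    simp [add_comm]
  have h1 : ∫ y, k ‖y‖ * f (z - y) = ∫ y, k ‖y‖ * f (y + z) := by
    rw [← integral_neg_eq_self]
    refine integral_congr_ae (ae_of_all _ fun y => ?_)
    simp [add_comm]
  have h2 : 0 ≤ ∫ y : ℂ, k ‖y‖ * (f (y + z) - b) := by
    refine integral_radial_mul_nonneg hk fun r hr h0 => ?_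
    obtain ⟨hc, hm⟩ := hb r hr h0
    rw [Real.circleAverage_map_add_const (f := fun y => f y - b) (c := z),
      Real.circleAverage_fun_sub hc (circleIntegrable_const b z r), Real.circleAverage_const]
    linarith
  simp only [mul_sub] at h2
  rw [integral_sub hf' (hki.mul_const b), integral_mul_const] at h2
  rw [h1]
  linarith

theorem const_mul_le_setIntegral_ball {f : ℂ → ℝ} (hf : Continuous f) {z : ℂ} {R a : ℝ}
    (hR : 0 ≤ R) (h : ∀ r, 0 < r → r < R → a ≤ Real.circleAverage f z r) :
    a * (Real.pi * R ^ 2) ≤ ∫ x in Metric.ball z R, f x := by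
  set k : ℝ → ℝ := fun r => if r < R then 1 else 0
  have hk : ∀ y : ℂ, k ‖y‖ = (Metric.ball (0 : ℂ) R).indicator 1 y := fun y => by
    by_cases hy : ‖y‖ < R <;> simp [k, hy]
  have hb : volume.real (Metric.ball (0 : ℂ) R) = Real.pi * R ^ 2 := by
    rw [Measure.real, Complex.volume_ball]
    simp [hR, mul_comm]
  have hball : ∫ x in Metric.ball z R, f x = ∫ y, k ‖y‖ * f (z - y) := by
    rw [← integral_indicator Metric.isOpen_ball.measurableSet, ← integral_sub_left_eq_self _ _ z]
    refine integral_congr_ae (ae_of_all _ fun y => ?_)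
    by_cases hy : ‖y‖ < R <;> simp [k, hy, Set.indicator]
  have hki : Integrable fun y : ℂ => k ‖y‖ := by
    simp only [hk]
    exact (integrable_indicator_iff Metric.isOpen_ball.measurableSet).2
      (integrableOn_const (by finiteness))
  have hint : ∫ y : ℂ, k ‖y‖ = Real.pi * R ^ 2 := by
    simp only [hk]
    rw [integral_indicator_one Metric.isOpen_ball.measurableSet, hb]
  rw [hball, ← hint]
  refine const_mul_integral_radial_le (fun r _ => by simp only [k]; split_ifs <;> norm_num) hki ?_
    fun r hr h0 => ⟨hf.continuousOn.circleIntegrable hr.le, h r hr ?_⟩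
  · have : Integrable ((Metric.ball (0 : ℂ) R).indicator fun y => f (z - y)) := by
      rw [integrable_indicator_iff Metric.isOpen_ball.measurableSet]
      have hc : Continuous fun y => f (z - y) := by fun_prop
      exact (hc.continuousOn.integrableOn_compact (isCompact_closedBall 0 R)).mono_set
        Metric.ball_subset_closedBall
    refine this.congr (ae_of_all _ fun y => ?_)
    by_cases hy : ‖y‖ < R <;> simp [k, hy]
  · by_contra hlt
    exact h0 (if_neg hlt)

theorem setIntegral_ball_le_const_mul {f : ℂ → ℝ} (hf : Continuous f) {z : ℂ} {R a : ℝ}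
    (hR : 0 ≤ R) (h : ∀ r, 0 < r → r < R → Real.circleAverage f z r ≤ a) :
    ∫ x in Metric.ball z R, f x ≤ a * (Real.pi * R ^ 2) := by
  have := const_mul_le_setIntegral_ball (f := fun x => -f x) hf.neg (a := -a) (z := z) hR fun r h1 h2 => by
    have e : Real.circleAverage (fun x => -f x) z r = - Real.circleAverage f z r := by
      simp [Real.circleAverage_def, intervalIntegral.integral_neg]
    rw [e]; exact neg_le_neg (h r h1 h2)
  rw [integral_neg] at this
  linarith

/-! ### The three circles theorem for continuous functions. -/

/-- The sub-mean value inequality on all circles. -/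
def SubMean (w : ℂ → ℝ) : Prop := ∀ z r, 0 < r → w z ≤ Real.circleAverage w z r

theorem circleAverage_norm_sub_sq (z₀ z : ℂ) (r : ℝ) :
    Real.circleAverage (fun x => ‖x - z₀‖ ^ 2) z r = ‖z - z₀‖ ^ 2 + r ^ 2 := by
  have h : ∀ θ, ‖circleMap z r θ - z₀‖ ^ 2 = (‖z - z₀‖ ^ 2 + r ^ 2) +
      ((2 * r * (z - z₀).re) * Real.cos θ + (2 * r * (z - z₀).im) * Real.sin θ) := fun θ => by
    rw [← Complex.normSq_eq_norm_sq, ← Complex.normSq_eq_norm_sq, Complex.normSq_apply,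
      Complex.normSq_apply, circleMap]
    simp only [Complex.add_re, Complex.sub_re, Complex.sub_im, Complex.add_im, Complex.re_ofReal_mul,
      Complex.im_ofReal_mul, Complex.exp_ofReal_mul_I_re, Complex.exp_ofReal_mul_I_im]
    linear_combination r ^ 2 * Real.sin_sq_add_cos_sq θ
  simp only [Real.circleAverage_def, h]
  have hc := Real.continuous_cos
  have hs := Real.continuous_sin
  rw [intervalIntegral.integral_add (by simp)
    (Continuous.intervalIntegrable (by fun_prop) _ _),
    intervalIntegral.integral_add (f := fun θ => 2 * r * (z - z₀).re * Real.cos θ)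
    (Continuous.intervalIntegrable (by fun_prop) _ _) (Continuous.intervalIntegrable (by fun_prop) _ _)]
  simp only [intervalIntegral.integral_const, intervalIntegral.integral_const_mul, integral_cos,
    integral_sin, smul_eq_mul, sub_zero, Real.sin_two_pi, Real.sin_zero, Real.cos_two_pi,
    Real.cos_zero, sub_self, mul_zero, add_zero]
  field_simp

/-- Three circles theorem for continuous subharmonic functions. -/
theorem SubMean.three_circles {w : ℂ → ℝ} (hw : Continuous w) (hs : SubMean w) {z₀ : ℂ}
    {ρ S a b : ℝ} (hρ : 0 < ρ) (h1 : ∀ z, ‖z - z₀‖ = ρ → w z ≤ a)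
    (h2 : ∀ z, ‖z - z₀‖ = S → w z ≤ a + b * Real.log (S / ρ)) {z : ℂ} (hz : ρ ≤ ‖z - z₀‖)
    (hz' : ‖z - z₀‖ ≤ S) : w z ≤ a + b * Real.log (‖z - z₀‖ / ρ) := by
  set K : Set ℂ := {x | ρ ≤ ‖x - z₀‖ ∧ ‖x - z₀‖ ≤ S} with hK
  have hKc : IsCompact K := by
    refine (isCompact_closedBall z₀ S).of_isClosed_subset ?_ fun x hx => ?_
    · have hc : Continuous fun x => ‖x - z₀‖ := by fun_prop
      exact (isClosed_le continuous_const hc).inter (isClosed_le hc continuous_const)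
    · simpa [dist_eq_norm] using hx.2
  have hzK : z ∈ K := ⟨hz, hz'⟩
  suffices H : ∀ η > 0, w z - a - b * (Real.log ‖z - z₀‖ - Real.log ρ) +
      η * (‖z - z₀‖ ^ 2 - S ^ 2) ≤ 0 by
    have hlim : Tendsto (fun η : ℝ => w z - a - b * (Real.log ‖z - z₀‖ - Real.log ρ) +
        η * (‖z - z₀‖ ^ 2 - S ^ 2)) (nhdsWithin 0 (Set.Ioi 0))
        (nhds (w z - a - b * (Real.log ‖z - z₀‖ - Real.log ρ) + 0 * (‖z - z₀‖ ^ 2 - S ^ 2))) := by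
      apply Tendsto.mono_left _ nhdsWithin_le_nhds
      apply Continuous.tendsto
      fun_prop
    have := le_of_tendsto hlim (eventually_nhdsWithin_of_forall H)
    rw [Real.log_div (by linarith) hρ.ne']
    linarith
  intro η hη
  set F : ℂ → ℝ := fun x => w x - a - b * (Real.log ‖x - z₀‖ - Real.log ρ) +
      η * (‖x - z₀‖ ^ 2 - S ^ 2) with hF
  have hlogc : ContinuousOn (fun x => Real.log ‖x - z₀‖) K := by
    refine ContinuousOn.log (by fun_prop) fun x hx => ?_
    have := hx.1; linarith
  have hFc : ContinuousOn F K := by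
    have := hw.continuousOn (s := K)
    fun_prop
  obtain ⟨z₁, hz₁, hmax⟩ := hKc.exists_isMaxOn ⟨z, hzK⟩ hFc
  refine (hmax hzK).trans ?_
  by_contra! hpos
  change 0 < F z₁ at hpos
  rcases hz₁.1.eq_or_lt with he | hlt1
  · have := h1 z₁ he.symm
    simp only [hF, ← he] at hpos
    have h3 : ρ ^ 2 ≤ S ^ 2 := by gcongr; linarith [hz₁.2]
    nlinarith
  rcases hz₁.2.eq_or_lt with he | hlt2
  · have := h2 z₁ he
    rw [Real.log_div (by linarith) hρ.ne'] at this
    simp only [hF, he] at hpos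
    linarith
  -- The circle of radius `r` stays in the annulus and does not enclose `z₀`, so the mean of `log ‖x
  -- - z₀‖` equals its value at the centre.
  set r := min (‖z₁ - z₀‖ - ρ) (S - ‖z₁ - z₀‖) with hr
  have hr0 : 0 < r := lt_min (by linarith) (by linarith)
  have hrle : r ≤ ‖z₁ - z₀‖ := (min_le_left _ _).trans (by linarith)
  have hsub : Metric.sphere z₁ |r| ⊆ K := by
    intro x hx
    rw [abs_of_pos hr0, mem_sphere_iff_norm] at hx
    have e1 : ‖x - z₀‖ ≤ ‖x - z₁‖ + ‖z₁ - z₀‖ := norm_sub_le_norm_sub_add_norm_sub _ _ _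
    have e2 : ‖z₁ - z₀‖ ≤ ‖z₁ - x‖ + ‖x - z₀‖ := norm_sub_le_norm_sub_add_norm_sub _ _ _
    rw [norm_sub_rev z₁ x] at e2
    exact ⟨by linarith [min_le_left (‖z₁ - z₀‖ - ρ) (S - ‖z₁ - z₀‖)],
      by linarith [min_le_right (‖z₁ - z₀‖ - ρ) (S - ‖z₁ - z₀‖)]⟩
  have hsub' : Metric.sphere z₁ r ⊆ K := by rwa [abs_of_pos hr0] at hsub
  have hle : Real.circleAverage F z₁ r ≤ F z₁ :=
    Real.circleAverage_mono_on_of_le_circle ((hFc.mono hsub').circleIntegrable hr0.le)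
      fun x hx => hmax (hsub hx)
  have i1 : CircleIntegrable w z₁ r := hw.continuousOn.circleIntegrable hr0.le
  have i2 : CircleIntegrable (fun x => Real.log ‖x - z₀‖) z₁ r :=
    (hlogc.mono hsub').circleIntegrable hr0.le
  have i3 : CircleIntegrable (fun x => ‖x - z₀‖ ^ 2) z₁ r :=
    (Continuous.continuousOn (by fun_prop)).circleIntegrable hr0.le
  have hlogav : Real.circleAverage (fun x => Real.log ‖x - z₀‖) z₁ r = Real.log ‖z₁ - z₀‖ := by
    rw [circleAverage_log_norm_sub_const_eq_log_radius_add_posLog hr0.ne', Real.posLog_eq_log,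
      Real.log_mul (by positivity) (by linarith), Real.log_inv]
    · ring
    · rw [abs_of_nonneg (by positivity), inv_mul_eq_div, one_le_div hr0]
      exact hrle
  have hav : Real.circleAverage F z₁ r = Real.circleAverage w z₁ r - b * Real.log ‖z₁ - z₀‖ +
      η * (‖z₁ - z₀‖ ^ 2 + r ^ 2) + (- a + b * Real.log ρ - η * S ^ 2) := by
    have : F = fun x => (w x - b * Real.log ‖x - z₀‖ + η * ‖x - z₀‖ ^ 2) +
        (- a + b * Real.log ρ - η * S ^ 2) := by ext x; simp only [hF]; ring
    have j2 : CircleIntegrable (fun x => b * Real.log ‖x - z₀‖) z₁ r := i2.const_mul b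
    have j3 : CircleIntegrable (fun x => η * ‖x - z₀‖ ^ 2) z₁ r := i3.const_mul η
    have j4 : CircleIntegrable (fun x => w x - b * Real.log ‖x - z₀‖) z₁ r := i1.sub j2
    have j5 : CircleIntegrable (fun x => w x - b * Real.log ‖x - z₀‖ + η * ‖x - z₀‖ ^ 2) z₁ r :=
      j4.add j3
    rw [this, Real.circleAverage_fun_add j5 (circleIntegrable_const _ _ _),
      Real.circleAverage_const, Real.circleAverage_fun_add j4 j3,
      Real.circleAverage_fun_sub i1 j2]
    have k1 := Real.circleAverage_fun_smul (c := z₁) (R := r) (a := b)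
      (f := fun x => Real.log ‖x - z₀‖)
    have k2 := Real.circleAverage_fun_smul (c := z₁) (R := r) (a := η)
      (f := fun x => ‖x - z₀‖ ^ 2)
    simp only [smul_eq_mul] at k1 k2
    rw [k1, k2, hlogav, circleAverage_norm_sub_sq]
  have hsm := hs z₁ r hr0
  have : F z₁ = w z₁ - b * Real.log ‖z₁ - z₀‖ +
      η * ‖z₁ - z₀‖ ^ 2 + (- a + b * Real.log ρ - η * S ^ 2) := by simp only [hF]; ring
  have h4 : 0 < η * r ^ 2 := by positivity
  nlinarith

/-! ### Functions with a continuous Riesz density. -/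

theorem integrable_logKernel_mul {w : ℂ → ℝ} (hw : Continuous w) {L : ℝ} (hL : 0 ≤ L) (z : ℂ) :
    Integrable (fun y => logKernel L y * w (z - y)) := by
  obtain ⟨W, hW, hWc, hWw⟩ := exists_cutoff hw z L
  refine (integrable_kernel_mul (integrable_logKernel hL).locallyIntegrable hW hWc z).congr
    (ae_of_all _ fun y => ?_)
  simp only
  rcases lt_or_ge ‖y‖ L with hy | hy
  · rw [hWw (by simpa [dist_eq_norm] using hy.le)]
  · rw [logKernel_eq_zero hL hy, zero_mul, zero_mul]

theorem logKernel_mono {L L' : ℝ} (hL : 0 ≤ L) (h : L ≤ L') (y : ℂ) :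
    logKernel L y ≤ logKernel L' y :=
  Real.posLog_le_posLog (by positivity) (by gcongr)

theorem logPot_mono {μ : ℂ → ℝ} (hμ : Continuous μ) (hμ0 : ∀ z, 0 ≤ μ z) {L L' : ℝ} (hL : 0 ≤ L)
    (h : L ≤ L') (z : ℂ) : logPot L μ z ≤ logPot L' μ z :=
  integral_mono (integrable_logKernel_mul hμ hL z) (integrable_logKernel_mul hμ (hL.trans h) z)
    fun y => mul_le_mul_of_nonneg_right (logKernel_mono hL h y) (hμ0 _)

theorem logPot_nonneg {μ : ℂ → ℝ} (hμ0 : ∀ z, 0 ≤ μ z) (L : ℝ) (z : ℂ) : 0 ≤ logPot L μ z :=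
  integral_nonneg fun y => mul_nonneg (logKernel_nonneg L y) (hμ0 _)

/-- `f` is a continuous subharmonic function whose Riesz measure has the continuous density `μ`. -/
structure HasRieszDensity (f μ : ℂ → ℝ) : Prop where
  continuous_fun : Continuous f
  continuous_density : Continuous μ
  density_nonneg : ∀ z, 0 ≤ μ z
  circleAverage_eq : ∀ z L, 0 < L → Real.circleAverage f z L = f z + logPot L μ z

namespace HasRieszDensity

variable {f μ : ℂ → ℝ}

theorem le_circleAverage (h : HasRieszDensity f μ) (z : ℂ) {r : ℝ} (hr : 0 < r) :
    f z ≤ Real.circleAverage f z r := by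
  rw [h.circleAverage_eq z r hr]
  linarith [logPot_nonneg h.density_nonneg r z]

theorem circleAverage_mono (h : HasRieszDensity f μ) (z : ℂ) {r R : ℝ} (hr : 0 < r) (hR : r ≤ R) :
    Real.circleAverage f z r ≤ Real.circleAverage f z R := by
  rw [h.circleAverage_eq z r hr, h.circleAverage_eq z R (hr.trans_le hR)]
  linarith [logPot_mono h.continuous_density h.density_nonneg hr.le hR z]

/-- A lower bound at one point of the circle `|z| = S` gives a lower bound for all means over
circles of radius `S` with centre in the disc of radius `3 S`. -/
theorem le_circleAverage_of_le (h : HasRieszDensity f μ) {M B S : ℝ} (hS : 0 < S)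
    (hM : ∀ z, ‖z‖ ≤ 6 * S → f z ≤ M) {ζ : ℂ} (hζ : ‖ζ‖ = S) (hB : B ≤ f ζ) {z : ℂ}
    (hz : ‖z‖ ≤ 3 * S) : M - 25 * (M - B) ≤ Real.circleAverage f z S := by
  have hc := h.continuous_fun
  have hv : Continuous fun x => M - f x := by fun_prop
  have hav : ∀ x r, 0 < r → Real.circleAverage (fun x => M - f x) x r =
      M - Real.circleAverage f x r := fun x r hr => by
    rw [Real.circleAverage_fun_sub (circleIntegrable_const _ _ _)
      (hc.continuousOn.circleIntegrable hr.le), Real.circleAverage_const]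
  have h1 := const_mul_le_setIntegral_ball hv (z := z) (a := M - Real.circleAverage f z S) hS.le
    fun r h0 h1 => by
      rw [hav z r h0]
      linarith [h.circleAverage_mono z h0 h1.le]
  -- Since `‖z - ζ‖ ≤ 4S`, the disc of radius `5S` about `ζ` contains the disc of radius `S` about
  -- `z`, and it lies in `‖x‖ ≤ 6S`, where `M - f ≥ 0`. The factor `25` is the ratio of the areas.
  have h2 := setIntegral_ball_le_const_mul hv (z := ζ) (R := 5 * S) (a := M - B) (by positivity)
    fun r h0 h1 => by
      rw [hav ζ r h0]
      linarith [h.le_circleAverage ζ h0]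
  have h3 : ∫ x in Metric.ball z S, (M - f x) ≤ ∫ x in Metric.ball ζ (5 * S), (M - f x) := by
    refine setIntegral_mono_set ?_ ?_ (Eventually.of_forall ?_)
    · exact (hv.continuousOn.integrableOn_compact (isCompact_closedBall ζ (5 * S))).mono_set
        Metric.ball_subset_closedBall
    · refine (ae_restrict_iff' Metric.isOpen_ball.measurableSet).2 (ae_of_all _ fun x hx => ?_)
      rw [mem_ball_iff_norm] at hx
      have : ‖x‖ ≤ ‖x - ζ‖ + ‖ζ‖ := by simpa using norm_add_le (x - ζ) ζ
      exact sub_nonneg.2 (hM x (by linarith))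
    · refine Metric.ball_subset_ball' ?_
      rw [dist_eq_norm]
      linarith [norm_sub_le z ζ]
  have h4 : 0 < Real.pi * S ^ 2 := by positivity
  have h5 : (M - Real.circleAverage f z S) * (Real.pi * S ^ 2) ≤
      (25 * (M - B)) * (Real.pi * S ^ 2) := by
    refine h1.trans (h3.trans (h2.trans (le_of_eq ?_)))
    ring
  linarith [le_of_mul_le_mul_right h5 h4]

theorem logKernel_sub_eq {L L' : ℝ} (hL : 0 < L) (h : L ≤ L') {y : ℂ} (hy : y ≠ 0) :
    (Metric.ball (0 : ℂ) L).indicator (fun _ => Real.log (L' / L)) y ≤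
      logKernel L' y - logKernel L y ∧
    logKernel L' y - logKernel L y ≤
      (Metric.ball (0 : ℂ) L').indicator (fun _ => Real.log (L' / L)) y := by
  have hy0 := norm_pos_iff.2 hy
  have hlog : 0 ≤ Real.log (L' / L) := Real.log_nonneg ((one_le_div hL).2 h)
  have hL' := hL.trans_le h
  have hd : ∀ T : ℝ, 0 < T → T ≥ ‖y‖ → logKernel T y = Real.log T - Real.log ‖y‖ := fun T h0 hT => by
    rw [logKernel, Real.posLog_eq_log, Real.log_div h0.ne' hy0.ne']
    rw [abs_of_pos (by positivity)]
    exact (one_le_div hy0).2 hT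
  rcases lt_or_ge ‖y‖ L with h1 | h1
  · rw [Set.indicator_of_mem (by simpa using h1), Set.indicator_of_mem (by simpa using h1.trans_le h),
      hd L hL h1.le, hd L' hL' (h1.le.trans h), Real.log_div hL'.ne' hL.ne']
    constructor <;> linarith
  · rw [Set.indicator_of_notMem (by simpa using h1), logKernel_eq_zero hL.le h1, sub_zero]
    refine ⟨logKernel_nonneg _ _, ?_⟩
    rcases lt_or_ge ‖y‖ L' with h2 | h2
    · rw [Set.indicator_of_mem (by simpa using h2), hd L' hL' h2.le, Real.log_div hL'.ne' hL.ne']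
      linarith [Real.log_le_log hL h1]
    · rw [logKernel_eq_zero hL'.le h2]
      exact Set.indicator_nonneg (fun _ _ => hlog) _

/-- The increment of the circle means is controlled by the Riesz masses of discs. -/
theorem log_mul_mass_le (h : HasRieszDensity f μ) {L L' : ℝ} (hL : 0 < L) (hLL' : L ≤ L') :
    Real.log (L' / L) * ∫ y in Metric.ball 0 L, μ y ≤
      Real.circleAverage f 0 L' - Real.circleAverage f 0 L ∧
    Real.circleAverage f 0 L' - Real.circleAverage f 0 L ≤
      Real.log (L' / L) * ∫ y in Metric.ball 0 L', μ y := by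
  have hL' := hL.trans_le hLL'
  have hm := h.continuous_density
  have hmass : ∀ T : ℝ, Real.log (L' / L) * ∫ y in Metric.ball 0 T, μ y =
      ∫ y, (Metric.ball (0 : ℂ) T).indicator (fun _ => Real.log (L' / L)) y * μ (0 - y) := fun T => by
    rw [← integral_const_mul, ← integral_indicator Metric.isOpen_ball.measurableSet,
      ← integral_neg_eq_self]
    refine integral_congr_ae (ae_of_all _ fun y => ?_)
    by_cases hy : ‖y‖ < T <;> simp [hy, Set.indicator]
  have hint : ∀ T : ℝ, Integrable fun y =>
      (Metric.ball (0 : ℂ) T).indicator (fun _ => Real.log (L' / L)) y * μ (0 - y) := fun T => by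
    have hc : Continuous fun y => Real.log (L' / L) * μ (0 - y) := by fun_prop
    have : IntegrableOn (fun y => Real.log (L' / L) * μ (0 - y)) (Metric.ball 0 T) :=
      (hc.continuousOn.integrableOn_compact (isCompact_closedBall 0 T)).mono_set
        Metric.ball_subset_closedBall
    rw [← integrable_indicator_iff Metric.isOpen_ball.measurableSet] at this
    refine this.congr (ae_of_all _ fun y => ?_)
    by_cases hy : ‖y‖ < T <;> simp [hy, Set.indicator]
  have h0 : ∀ᵐ y : ℂ, y ≠ 0 := by simp [ae_iff]
  have hdiff : Real.circleAverage f 0 L' - Real.circleAverage f 0 L =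
      ∫ y, (logKernel L' y - logKernel L y) * μ (0 - y) := by
    rw [h.circleAverage_eq 0 L' hL', h.circleAverage_eq 0 L hL, logPot, logPot]
    simp only [sub_mul]
    rw [integral_sub (integrable_logKernel_mul hm hL'.le 0) (integrable_logKernel_mul hm hL.le 0)]
    ring
  have hdi : Integrable fun y => (logKernel L' y - logKernel L y) * μ (0 - y) := by
    simp only [sub_mul]
    exact (integrable_logKernel_mul hm hL'.le 0).sub (integrable_logKernel_mul hm hL.le 0)
  rw [hmass, hmass, hdiff]
  constructor
  · refine integral_mono_ae (hint L) hdi ?_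
    filter_upwards [h0] with y hy
    exact mul_le_mul_of_nonneg_right (logKernel_sub_eq hL hLL' hy).1 (h.density_nonneg _)
  · refine integral_mono_ae hdi (hint L') ?_
    filter_upwards [h0] with y hy
    exact mul_le_mul_of_nonneg_right (logKernel_sub_eq hL hLL' hy).2 (h.density_nonneg _)

end HasRieszDensity

/-! ### Exponential integrability on one annulus. -/

/-- Jensen's inequality for the normalized measure: total mass at most `1/t` lets `t ∫ p` be
replaced by the average of `p`. The summand `1` covers the zero measure and non-integrable `p`,
where the left side is `1`. -/
theorem ofReal_exp_integral_le {α : Type*} [MeasurableSpace α] {ν : Measure α} [IsFiniteMeasure ν]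
    {t : ℝ} (hν : t * ν.real Set.univ ≤ 1) {p : α → ℝ} (hp : ∀ x, 0 ≤ p x)
    (hpm : Measurable p) :
    ENNReal.ofReal (Real.exp (t * ∫ x, p x ∂ν)) ≤
      1 + (ν Set.univ)⁻¹ * ∫⁻ x, ENNReal.ofReal (Real.exp (p x)) ∂ν := by
  rcases eq_or_ne ν 0 with rfl | h0
  · simp
  have hne : NeZero ν := ⟨h0⟩
  have hm0 : ν Set.univ ≠ 0 := by simpa using h0
  by_cases hi : Integrable p ν
  swap
  · rw [integral_undef hi]; simp
  by_cases hfin : ∫⁻ x, ENNReal.ofReal (Real.exp (p x)) ∂ν = ⊤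
  · rw [hfin, ENNReal.mul_top (by simp), add_top]; exact le_top
  have hie : Integrable (fun x => Real.exp (p x)) ν := by
    refine ⟨by fun_prop, ?_⟩
    rw [hasFiniteIntegral_iff_ofReal (ae_of_all _ fun x => (Real.exp_pos _).le)]
    exact lt_top_iff_ne_top.2 hfin
  have hmpos : 0 < ν.real Set.univ := by
    rw [Measure.real]; exact ENNReal.toReal_pos hm0 (by finiteness)
  have key := convexOn_exp.map_average_le Real.continuous_exp.continuousOn isClosed_univ
    (ae_of_all ν fun x => Set.mem_univ (p x)) hi hie
  rw [average_eq, average_eq, smul_eq_mul, smul_eq_mul] at key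
  have hle : t * ∫ x, p x ∂ν ≤ (ν.real Set.univ)⁻¹ * ∫ x, p x ∂ν := by
    refine mul_le_mul_of_nonneg_right ?_ (integral_nonneg hp)
    rw [← one_div]
    exact (le_div_iff₀ hmpos).2 hν
  refine le_trans ?_ le_add_self
  calc ENNReal.ofReal (Real.exp (t * ∫ x, p x ∂ν))
      ≤ ENNReal.ofReal ((ν.real Set.univ)⁻¹ * ∫ x, Real.exp (p x) ∂ν) :=
        ENNReal.ofReal_le_ofReal ((Real.exp_le_exp.2 hle).trans key)
    _ = _ := by
        rw [ENNReal.ofReal_mul (by positivity), ENNReal.ofReal_inv_of_pos hmpos, Measure.real,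
          ENNReal.ofReal_toReal (by finiteness),
          ofReal_integral_eq_lintegral_ofReal hie (ae_of_all _ fun x => (Real.exp_pos _).le)]

/-- The exponential of the kernel is `max(1, S/|y|)`, and `1/|y|` is integrable on discs of the
plane. The bound does not depend on `w`. -/
theorem lintegral_exp_logKernel_le {S : ℝ} (hS : 0 ≤ S) (Z : Set ℂ) (w : ℂ) :
    ∫⁻ z in Z, ENNReal.ofReal (Real.exp (logKernel S (z - w))) ≤
      volume Z + ENNReal.ofReal (2 * Real.pi * S ^ 2) := by
  have hb : ∀ y : ℂ, ENNReal.ofReal (Real.exp (logKernel S y)) ≤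
      1 + (Metric.ball (0 : ℂ) S).indicator (fun y => ENNReal.ofReal S * ENNReal.ofReal ‖y‖⁻¹) y := by
    intro y
    rcases lt_or_ge ‖y‖ S with hy | hy
    · rw [Set.indicator_of_mem (by simpa using hy), ← ENNReal.ofReal_mul hS, ← ENNReal.ofReal_one,
        ← ENNReal.ofReal_add zero_le_one (by positivity)]
      refine ENNReal.ofReal_le_ofReal ?_
      rw [logKernel, Real.posLog_eq_log_max_one (by positivity), Real.exp_log (by positivity),
        ← div_eq_mul_inv]
      have : 0 ≤ S / ‖y‖ := by positivity
      exact max_le (by linarith) (by linarith)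
    · rw [logKernel_eq_zero hS hy]; simp
  calc ∫⁻ z in Z, ENNReal.ofReal (Real.exp (logKernel S (z - w)))
      ≤ ∫⁻ z in Z, (1 + (Metric.ball (0 : ℂ) S).indicator
          (fun y => ENNReal.ofReal S * ENNReal.ofReal ‖y‖⁻¹) (z - w)) :=
        lintegral_mono fun z => hb (z - w)
    _ = volume Z + ∫⁻ z in Z, (Metric.ball (0 : ℂ) S).indicator
          (fun y => ENNReal.ofReal S * ENNReal.ofReal ‖y‖⁻¹) (z - w) := by
        rw [lintegral_add_left measurable_const, setLIntegral_one]
    _ ≤ volume Z + ∫⁻ z, (Metric.ball (0 : ℂ) S).indicator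
          (fun y => ENNReal.ofReal S * ENNReal.ofReal ‖y‖⁻¹) (z - w) := by
        gcongr; exact Measure.restrict_le_self
    _ = _ := by
        rw [lintegral_sub_right_eq_self, lintegral_indicator Metric.isOpen_ball.measurableSet,
          lintegral_const_mul _ (by fun_prop), lintegral_ball_inv_norm hS, ← ENNReal.ofReal_mul hS]
        congr 2; ring

/-- Skoda-type estimate on an annulus carrying a small Riesz mass. -/
theorem HasRieszDensity.lintegral_annulus_le {f μ : ℂ → ℝ} (h : HasRieszDensity f μ)
    {S t B : ℝ} (hS : 0 < S) (ht : 0 ≤ t)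
    (hmass : t * ((∫ y in Metric.ball 0 (4 * S), μ y) - ∫ y in Metric.ball 0 S, μ y) ≤ 1)
    (hB : ∀ z, ‖z‖ ≤ 3 * S → B ≤ Real.circleAverage f z S) :
    ∫⁻ z in {z : ℂ | 2 * S ≤ ‖z‖ ∧ ‖z‖ ≤ 3 * S}, ENNReal.ofReal (Real.exp (-(t * f z))) ≤
      ENNReal.ofReal (20 * Real.pi * S ^ 2 * Real.exp (-(t * B))) := by
  set Z : Set ℂ := {z : ℂ | 2 * S ≤ ‖z‖ ∧ ‖z‖ ≤ 3 * S} with hZ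
  have hZm : MeasurableSet Z :=
    (measurableSet_le measurable_const measurable_norm).inter
      (measurableSet_le measurable_norm measurable_const)
  have hZvol : volume Z ≤ ENNReal.ofReal (9 * Real.pi * S ^ 2) := by
    refine (measure_mono (t := Metric.closedBall (0 : ℂ) (3 * S)) fun z hz => ?_).trans_eq ?_
    · simpa using hz.2
    · rw [Complex.volume_closedBall, ← ENNReal.ofReal_pow (by positivity),
        ← ENNReal.ofReal_coe_nnreal, NNReal.coe_real_pi, ← ENNReal.ofReal_mul (by positivity)]
      congr 1; ring
  have hm := h.continuous_density
  set N : Set ℂ := Metric.ball 0 (4 * S) \ Metric.ball 0 S with hN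
  have hNm : MeasurableSet N := Metric.isOpen_ball.measurableSet.diff Metric.isOpen_ball.measurableSet
  have hib : ∀ T : ℝ, IntegrableOn μ (Metric.ball 0 T) := fun T =>
    (hm.continuousOn.integrableOn_compact (isCompact_closedBall 0 T)).mono_set
        Metric.ball_subset_closedBall
  have hiN : IntegrableOn μ N := (hib _).mono_set Set.sdiff_subset
  set d : ℂ → ℝ≥0∞ := fun y => ENNReal.ofReal (μ y) with hd
  have hdm : Measurable d := by fun_prop
  set ν : Measure ℂ := (volume.restrict N).withDensity d with hν
  have hνuniv : ν Set.univ = ENNReal.ofReal (∫ y in N, μ y) := by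
    rw [hν, withDensity_apply _ MeasurableSet.univ, Measure.restrict_univ,
      ofReal_integral_eq_lintegral_ofReal hiN (ae_of_all _ h.density_nonneg)]
  have hfin : IsFiniteMeasure ν := ⟨by rw [hνuniv]; exact ENNReal.ofReal_lt_top⟩
  have hνreal : ν.real Set.univ =
      (∫ y in Metric.ball 0 (4 * S), μ y) - ∫ y in Metric.ball 0 S, μ y := by
    rw [Measure.real, hνuniv, ENNReal.toReal_ofReal (integral_nonneg h.density_nonneg), hN,
      setIntegral_sdiff Metric.isOpen_ball.measurableSet (hib _)
        (Metric.ball_subset_ball (by linarith))]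
  -- For `2S ≤ ‖z‖ ≤ 3S` the disc of radius `S` about `z` lies in `N`, so only the mass in `N`
  -- enters the potential.
  have hpot : ∀ z ∈ Z, logPot S μ z = ∫ w, logKernel S (z - w) ∂ν := by
    intro z hz
    rw [hν, integral_withDensity_eq_integral_toReal_smul hdm (by simp [hd]), logPot,
      ← integral_sub_left_eq_self _ _ z, ← integral_indicator hNm]
    refine integral_congr_ae (ae_of_all _ fun w => ?_)
    simp only [sub_sub_cancel]
    by_cases hw : w ∈ N
    · rw [Set.indicator_of_mem hw, hd, ENNReal.toReal_ofReal (h.density_nonneg w), smul_eq_mul,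
        mul_comm]
    · rw [Set.indicator_of_notMem hw, logKernel_eq_zero hS.le, zero_mul]
      by_contra! hlt
      apply hw
      have h1 : ‖z‖ ≤ ‖z - w‖ + ‖w‖ := by simpa using norm_add_le (z - w) w
      have h2 : ‖w‖ ≤ ‖z‖ + ‖z - w‖ := by
        calc ‖w‖ = ‖z - (z - w)‖ := by congr 1; ring
          _ ≤ _ := norm_sub_le _ _
      simp only [hN, Set.mem_sdiff, mem_ball_zero_iff, not_lt]
      constructor <;> linarith [hz.1, hz.2]
  have hpt : ∀ z ∈ Z, ENNReal.ofReal (Real.exp (-(t * f z))) ≤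
      ENNReal.ofReal (Real.exp (-(t * B))) * (1 + (ν Set.univ)⁻¹ *
        ∫⁻ w, ENNReal.ofReal (Real.exp (logKernel S (z - w))) ∂ν) := by
    intro z hz
    have h1 := h.circleAverage_eq z S hS
    have h2 := hB z hz.2
    rw [hpot z hz] at h1
    have h3 := ofReal_exp_integral_le (ν := ν) (by rwa [hνreal])
      (p := fun w => logKernel S (z - w)) (fun w => logKernel_nonneg _ _)
      ((measurable_logKernel S).comp (by fun_prop))
    refine le_trans ?_ (mul_le_mul_right h3 _)
    rw [← ENNReal.ofReal_mul (Real.exp_pos _).le, ← Real.exp_add]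
    refine ENNReal.ofReal_le_ofReal (Real.exp_le_exp.2 ?_)
    have : t * B ≤ t * (f z + ∫ w, logKernel S (z - w) ∂ν) :=
      mul_le_mul_of_nonneg_left (by linarith) ht
    linarith
  have hKm : Measurable fun q : ℂ × ℂ => ENNReal.ofReal (Real.exp (logKernel S (q.1 - q.2))) :=
    (Real.measurable_exp.comp ((measurable_logKernel S).comp (by fun_prop))).ennreal_ofReal
  calc ∫⁻ z in Z, ENNReal.ofReal (Real.exp (-(t * f z)))
      ≤ ∫⁻ z in Z, ENNReal.ofReal (Real.exp (-(t * B))) * (1 + (ν Set.univ)⁻¹ *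
        ∫⁻ w, ENNReal.ofReal (Real.exp (logKernel S (z - w))) ∂ν) :=
        setLIntegral_mono' hZm hpt
    _ = ENNReal.ofReal (Real.exp (-(t * B))) * (volume Z + (ν Set.univ)⁻¹ *
        ∫⁻ w, (∫⁻ z in Z, ENNReal.ofReal (Real.exp (logKernel S (z - w)))) ∂ν) := by
        rw [lintegral_const_mul' _ _ ENNReal.ofReal_ne_top, lintegral_add_left measurable_const,
          setLIntegral_one, lintegral_const_mul _ hKm.lintegral_prod_right',
          lintegral_lintegral_swap (f := fun z w => ENNReal.ofReal (Real.exp (logKernel S (z - w))))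
            hKm.aemeasurable]
    _ ≤ ENNReal.ofReal (Real.exp (-(t * B))) * (volume Z + (ν Set.univ)⁻¹ *
        ∫⁻ w, (volume Z + ENNReal.ofReal (2 * Real.pi * S ^ 2)) ∂ν) := by
        gcongr
        exact lintegral_exp_logKernel_le hS.le Z _
    _ ≤ ENNReal.ofReal (Real.exp (-(t * B))) * (volume Z +
        (volume Z + ENNReal.ofReal (2 * Real.pi * S ^ 2))) := by
        gcongr
        rw [lintegral_const, mul_comm (volume Z + _), ← mul_assoc]
        exact mul_le_of_le_one_left' (ENNReal.inv_mul_le_one _)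
    _ ≤ ENNReal.ofReal (Real.exp (-(t * B))) * (ENNReal.ofReal (9 * Real.pi * S ^ 2) +
        (ENNReal.ofReal (9 * Real.pi * S ^ 2) + ENNReal.ofReal (2 * Real.pi * S ^ 2))) := by
        gcongr
    _ = _ := by
        rw [← ENNReal.ofReal_add (by positivity) (by positivity),
          ← ENNReal.ofReal_add (by positivity) (by positivity),
          ← ENNReal.ofReal_mul (by positivity)]
        congr 1; ring

/-! ### Uniform estimate near infinity from logarithmic growth. -/

/-- `f` has growth at most `σ log |z| + A`, and at least `(σ - δ) log S - A` somewhere on every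
circle `|z| = S` with `S ≥ R₀`. -/
structure HasLogGrowth (A σ δ R₀ : ℝ) (f : ℂ → ℝ) : Prop where
  upper : ∀ z, f z ≤ A + σ * Real.posLog ‖z‖
  lower : ∀ S, R₀ ≤ S → ∃ ζ : ℂ, ‖ζ‖ = S ∧ (σ - δ) * Real.log S - A ≤ f ζ

namespace HasRieszDensity

variable {f μ : ℂ → ℝ} {A σ δ R₀ : ℝ}

theorem le_circleAverage_of_hasLogGrowth (h : HasRieszDensity f μ)
    (hg : HasLogGrowth A σ δ R₀ f) (hσ : 0 ≤ σ) (hR₀ : 1 ≤ R₀) {S : ℝ} (hS : R₀ ≤ S) {z : ℂ}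
    (hz : ‖z‖ ≤ 3 * S) :
    (σ - 25 * δ) * Real.log S - (49 * A + 24 * (σ * Real.log 6)) ≤ Real.circleAverage f z S := by
  obtain ⟨ζ, hζ, hB⟩ := hg.lower S hS
  have hM : ∀ z, ‖z‖ ≤ 6 * S → f z ≤ A + σ * (Real.log 6 + Real.log S) := fun z hz => by
    refine (hg.upper z).trans ?_
    rw [← Real.log_mul (by norm_num) (by linarith)]
    have h1 : Real.posLog ‖z‖ ≤ Real.posLog (6 * S) := Real.posLog_le_posLog (norm_nonneg _) hz
    rw [Real.posLog_eq_log (x := 6 * S) (by rw [abs_of_nonneg (by linarith)]; linarith)] at h1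
    gcongr
  have := h.le_circleAverage_of_le (by linarith) hM hζ hB hz
  linarith

theorem circleAverage_zero_le_of_hasLogGrowth (h : HasRieszDensity f μ)
    (hg : HasLogGrowth A σ δ R₀ f) {L : ℝ} (hL : 1 ≤ L) :
    Real.circleAverage f 0 L ≤ A + σ * Real.log L := by
  refine Real.circleAverage_mono_on_of_le_circle
    (h.continuous_fun.continuousOn.circleIntegrable (by linarith)) fun x hx => ?_
  have h1 := hg.upper x
  rw [abs_of_nonneg (by linarith), mem_sphere_zero_iff_norm] at hx
  rwa [hx, Real.posLog_eq_log (by rw [abs_of_nonneg (by linarith)]; exact hL)] at h1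

theorem mass_mono (h : HasRieszDensity f μ) {L L' : ℝ} (hL : L ≤ L') :
    ∫ y in Metric.ball 0 L, μ y ≤ ∫ y in Metric.ball 0 L', μ y := by
  refine setIntegral_mono_set ?_ (ae_of_all _ h.density_nonneg)
    (Eventually.of_forall (Metric.ball_subset_ball hL))
  exact (h.continuous_density.continuousOn.integrableOn_compact
    (isCompact_closedBall 0 L')).mono_set Metric.ball_subset_closedBall

/-- The means about `0` are `σ log L` up to `25δ log L` and a constant. Comparing radii `R` and `R²`
gives mass at least `σ - 51δ` in the disc of radius `R²`; comparing `4S` and `(4S)²` gives mass at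
most `σ + 26δ` in that of radius `4S`. In each case one further `δ` absorbs the constants through
`hRδ`. -/
theorem mass_annulus_le (h : HasRieszDensity f μ) (hg : HasLogGrowth A σ δ R₀ f) (hA : 0 ≤ A)
    (hσ : 0 ≤ σ) (hR₀ : 1 ≤ R₀) {R : ℝ} (hR : R₀ ≤ R) (hR1 : 1 < R)
    (hRδ : 50 * A + 24 * (σ * Real.log 6) ≤ δ * Real.log R) {S : ℝ} (hS : R ^ 2 ≤ S) :
    (∫ y in Metric.ball 0 (4 * S), μ y) - ∫ y in Metric.ball 0 S, μ y ≤ 77 * δ := by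
  have hlR : 0 < Real.log R := Real.log_pos hR1
  have hRS : R ≤ S := by nlinarith
  have hsq : ∀ x : ℝ, 0 < x → Real.log (x ^ 2 / x) = Real.log x := fun x hx => by
    congr 1; field_simp
  have hlsq : ∀ x : ℝ, Real.log (x ^ 2) = 2 * Real.log x := fun x => by simp
  have hlow := fun (T : ℝ) (hT : R₀ ≤ T) =>
    h.le_circleAverage_of_hasLogGrowth hg hσ hR₀ hT (z := 0) (by simp; linarith)
  have hup := fun (T : ℝ) (hT : 1 ≤ T) => h.circleAverage_zero_le_of_hasLogGrowth hg hT
  have m1 := (h.log_mul_mass_le (L := R) (L' := R ^ 2) (by linarith) (by nlinarith)).2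
  have m2 := (h.log_mul_mass_le (L := 4 * S) (L' := (4 * S) ^ 2) (by linarith) (by nlinarith)).1
  rw [hsq R (by linarith)] at m1
  rw [hsq (4 * S) (by linarith)] at m2
  have a1 := hlow (R ^ 2) (by nlinarith)
  have a2 := hup R hR1.le
  have a3 := hup ((4 * S) ^ 2) (by nlinarith)
  have a4 := hlow (4 * S) (by linarith)
  rw [hlsq] at a1 a3
  have hl4 : Real.log R ≤ Real.log (4 * S) := Real.log_le_log (by linarith) (by linarith)
  have hδ : 0 ≤ δ := by
    have : 0 ≤ Real.log 6 := Real.log_nonneg (by norm_num)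
    have : 0 ≤ 50 * A + 24 * (σ * Real.log 6) := by positivity
    by_contra! hneg
    nlinarith
  have e1 : (σ - 51 * δ) ≤ ∫ y in Metric.ball 0 (R ^ 2), μ y := by
    refine le_of_mul_le_mul_left ?_ hlR
    linarith
  have e2 : ∫ y in Metric.ball 0 (4 * S), μ y ≤ σ + 26 * δ := by
    refine le_of_mul_le_mul_left ?_ (hlR.trans_le hl4)
    have := mul_le_mul_of_nonneg_left hl4 hδ
    linarith
  have e3 := h.mass_mono hS
  linarith

end HasRieszDensity

/-- A bound of the integral of `e^{-tf}` near infinity which only depends on the growth of `f`. -/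
theorem exists_uniform_lintegral_exp_le {A σ δ R₀ t : ℝ} (hA : 0 ≤ A) (hσ : 0 ≤ σ) (hδ : 0 < δ)
    (hR₀ : 1 ≤ R₀) (ht : 0 ≤ t) (htδ : t * (77 * δ) ≤ 1) (htσ : 2 < t * (σ - 25 * δ)) :
    ∃ R : ℝ, ∃ K : ℝ≥0∞, K < ⊤ ∧ ∀ f μ : ℂ → ℝ, HasRieszDensity f μ → HasLogGrowth A σ δ R₀ f →
      ∫⁻ z in {z : ℂ | R ≤ ‖z‖}, ENNReal.ofReal (Real.exp (-(t * f z))) ≤ K := by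
  set C : ℝ := 49 * A + 24 * (σ * Real.log 6) with hC
  -- The exponential makes `A + C ≤ δ log R`, which absorbs all additive constants.
  set R : ℝ := max (max R₀ 2) (Real.exp ((A + C) / δ)) with hRdef
  have hR : R₀ ≤ R := (le_max_left _ _).trans (le_max_left _ _)
  have hR1 : 1 < R := lt_of_lt_of_le (by norm_num) ((le_max_right R₀ 2).trans (le_max_left _ _))
  have hRδ : 50 * A + 24 * (σ * Real.log 6) ≤ δ * Real.log R := by
    have h1 : Real.exp ((A + C) / δ) ≤ R := le_max_right _ _
    rw [← Real.le_log_iff_exp_le (by linarith), div_le_iff₀ hδ] at h1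
    linarith
  set κ : ℝ := t * (σ - 25 * δ) - 2 with hκ
  -- With ratio `3/2`, the outer radius `3 s k` equals the next inner radius `2 s (k + 1)`, so the
  -- annuli leave no gap.
  set s : ℕ → ℝ := fun k => R ^ 2 * (3 / 2) ^ k with hs
  have hs0 : ∀ k, R ^ 2 ≤ s k := fun k =>
    le_mul_of_one_le_right (by positivity) (one_le_pow₀ (by norm_num))
  have hRpos : 0 < R ^ 2 := by positivity
  set q : ℝ := Real.exp (-(κ * Real.log (3 / 2))) with hq
  have hq1 : q < 1 := by
    rw [hq, Real.exp_lt_one_iff]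
    have : 0 < Real.log (3 / 2) := Real.log_pos (by norm_num)
    have : 0 < κ * Real.log (3 / 2) := mul_pos (by linarith) this
    linarith
  set D : ℝ := 20 * Real.pi * Real.exp (t * C) * Real.exp (-(κ * Real.log (R ^ 2))) with hD
  have hterm : ∀ k, 20 * Real.pi * s k ^ 2 *
      Real.exp (-(t * ((σ - 25 * δ) * Real.log (s k) - C))) = D * q ^ k := by
    intro k
    have hsk : 0 < s k := hRpos.trans_le (hs0 k)
    have h1 : s k ^ 2 = Real.exp (2 * Real.log (s k)) := by
      rw [mul_comm, Real.exp_mul, Real.exp_log hsk]; norm_cast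
    have h2 : Real.log (s k) = Real.log (R ^ 2) + k * Real.log (3 / 2) := by
      rw [hs, Real.log_mul hRpos.ne' (by positivity), Real.log_pow (3 / 2)]
    rw [h1, hD, hq, ← Real.exp_nat_mul, mul_assoc (20 * Real.pi), mul_assoc (20 * Real.pi),
      mul_assoc (20 * Real.pi), ← Real.exp_add, ← Real.exp_add, ← Real.exp_add, h2]
    congr 2
    rw [hκ]; ring
  refine ⟨2 * R ^ 2, ∑' k, ENNReal.ofReal (D * q ^ k), ?_, fun f μ h hg => ?_⟩
  · exact Summable.tsum_ofReal_lt_top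
      ((summable_geometric_of_lt_one (Real.exp_pos _).le hq1).mul_left D)
  have hcover : {z : ℂ | 2 * R ^ 2 ≤ ‖z‖} ⊆ ⋃ k, {z : ℂ | 2 * s k ≤ ‖z‖ ∧ ‖z‖ ≤ 3 * s k} := by
    intro z hz
    have hz' : 1 ≤ ‖z‖ / (2 * R ^ 2) := (one_le_div (by positivity)).2 hz
    obtain ⟨k, hk1, hk2⟩ := exists_nat_pow_near hz' (y := (3 / 2 : ℝ)) (by norm_num)
    rw [le_div_iff₀ (by positivity)] at hk1
    rw [div_lt_iff₀ (by positivity), pow_succ] at hk2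
    refine Set.mem_iUnion.2 ⟨k, ?_, ?_⟩
    · simp only [hs]; linarith
    · simp only [hs]; linarith
  refine (lintegral_mono_set hcover).trans ((lintegral_iUnion_le _ _).trans
    (ENNReal.tsum_le_tsum fun k => ?_))
  rw [← hterm k]
  refine h.lintegral_annulus_le (hRpos.trans_le (hs0 k)) ht ?_ fun z hz => ?_
  · refine le_trans (mul_le_mul_of_nonneg_left ?_ ht) htδ
    exact h.mass_annulus_le hg hA hσ hR₀ hR hR1 hRδ (hs0 k)
  · refine h.le_circleAverage_of_hasLogGrowth hg hσ hR₀ ?_ hz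
    have := hs0 k
    nlinarith

/-! ### Smoothing by the logarithmic kernel. -/

theorem integral_kernel_mul_le {k : ℂ → ℝ} (hk : ∀ y, 0 ≤ k y) (hki : Integrable k) {h : ℝ}
    (hkh : ∀ y, h ≤ ‖y‖ → k y = 0) {f : ℂ → ℝ} {z : ℂ} (hf : Integrable fun y => k y * f (z - y))
    {B : ℝ} (hB : ∀ᵐ x, x ∈ Metric.ball z h → f x ≤ B) : ∫ y, k y * f (z - y) ≤ B * ∫ y, k y := by
  rw [mul_comm, ← integral_mul_const]
  refine integral_mono_ae hf (hki.mul_const B) ?_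
  filter_upwards [(Measure.measurePreserving_sub_left volume z).quasiMeasurePreserving.ae hB]
    with y hBy
  rcases lt_or_ge ‖y‖ h with hy | hy
  · exact mul_le_mul_of_nonneg_left (hBy (by simpa [dist_eq_norm] using hy)) (hk y)
  · simp [hkh y hy]

theorem integral_logKernel_pos {h : ℝ} (hh : 0 < h) : 0 < ∫ y, logKernel h y := by
  rw [integral_pos_iff_support_of_nonneg (logKernel_nonneg h) (integrable_logKernel hh.le)]
  refine lt_of_lt_of_le (Metric.measure_ball_pos volume ((h / 2 : ℝ) : ℂ)
    (show 0 < h / 4 by positivity)) (measure_mono fun y hy => ?_)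
  rw [mem_ball_iff_norm] at hy
  have e : ‖((h / 2 : ℝ) : ℂ)‖ = h / 2 := by rw [Complex.norm_real, Real.norm_of_nonneg (by positivity)]
  have h1 := norm_sub_norm_le ((h / 2 : ℝ) : ℂ) y
  have h2 := norm_sub_norm_le y ((h / 2 : ℝ) : ℂ)
  rw [norm_sub_rev] at h1
  have h3 : 1 < h / ‖y‖ := (one_lt_div (by linarith)).2 (by linarith)
  have h4 : 0 < logKernel h y := by
    rw [logKernel, Real.posLog_eq_log (by rw [abs_of_pos (by positivity)]; exact h3.le)]
    exact Real.log_pos h3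
  exact h4.ne'

/-- The average of `w` against the normalized kernel `log⁺ (h / |y|)`. -/
noncomputable def logMollify (h : ℝ) (w : ℂ → ℝ) (z : ℂ) : ℝ :=
  (∫ y, logKernel h y)⁻¹ * logPot h w z

section

variable {w : ℂ → ℝ} {h : ℝ}

theorem logMollify_le (hw : Continuous w) (hh : 0 < h) {z : ℂ} {B : ℝ}
    (hB : ∀ x ∈ Metric.ball z h, w x ≤ B) : logMollify h w z ≤ B := by
  rw [logMollify, inv_mul_le_iff₀ (integral_logKernel_pos hh), mul_comm]
  exact integral_kernel_mul_le (logKernel_nonneg h) (integrable_logKernel hh.le)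
    (fun y hy => logKernel_eq_zero hh.le hy) (integrable_logKernel_mul hw hh.le z) (ae_of_all _ hB)

theorem SubMean.le_logMollify (hs : SubMean w) (hw : Continuous w) (hh : 0 < h) (z : ℂ) :
    w z ≤ logMollify h w z := by
  rw [logMollify, le_inv_mul_iff₀ (integral_logKernel_pos hh), mul_comm]
  exact const_mul_integral_radial_le (k := fun r => Real.posLog (h / r))
    (fun r _ => Real.posLog_nonneg) (integrable_logKernel hh.le)
    (integrable_logKernel_mul hw hh.le z)
    fun r hr _ => ⟨hw.continuousOn.circleIntegrable hr.le, hs z r hr⟩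

/-- This is why the kernel is logarithmic: `circleAverage_logPot` exhibits the density, whose
positivity is the sub-mean inequality itself. No differentiability of `w` is needed. -/
theorem SubMean.hasRieszDensity_logMollify (hs : SubMean w) (hw : Continuous w) (hh : 0 < h) :
    HasRieszDensity (logMollify h w)
      (fun z => (∫ y, logKernel h y)⁻¹ * (Real.circleAverage w z h - w z)) := by
  have hc := integral_logKernel_pos hh
  refine ⟨(continuous_logPot hw hh.le).const_smul (∫ y, logKernel h y)⁻¹,
    ((continuous_circleAverage hw h).sub hw).const_smul (∫ y, logKernel h y)⁻¹,
    fun z => mul_nonneg (by positivity) (sub_nonneg.2 (hs z h hh)), fun z L hL => ?_⟩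
  have h1 : Real.circleAverage (logMollify h w) z L =
      (∫ y, logKernel h y)⁻¹ * Real.circleAverage (logPot h w) z L :=
    Real.circleAverage_fun_smul (a := (∫ y, logKernel h y)⁻¹) (f := logPot h w)
  rw [h1, circleAverage_logPot hw hh hL, mul_add, ← logMollify]
  congr 1
  rw [logPot, logPot, ← integral_const_mul]
  refine integral_congr_ae (ae_of_all _ fun y => ?_)
  simp only
  ring

theorem tendsto_logMollify (hs : SubMean w) (hw : Continuous w) (z : ℂ) :
    Tendsto (fun n : ℕ => logMollify (1 / ((n : ℝ) + 1)) w z) atTop (nhds (w z)) := by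
  refine tendsto_order.2 ⟨fun a ha => Eventually.of_forall fun n =>
    ha.trans_le (hs.le_logMollify hw (by positivity) z), fun a ha => ?_⟩
  obtain ⟨b, hb1, hb2⟩ := exists_between ha
  obtain ⟨r, hr, hball⟩ := Metric.mem_nhds_iff.1 (hw.continuousAt.eventually_lt
    (continuousAt_const (y := b)) hb1)
  have h0 := (tendsto_one_div_add_atTop_nhds_zero_nat (𝕜 := ℝ)).eventually_lt_const hr
  filter_upwards [h0] with n hn
  refine (logMollify_le hw (by positivity) fun x hx => ?_).trans_lt hb2
  have : x ∈ Metric.ball z r := Metric.ball_subset_ball hn.le hx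
  exact (hball this).le

theorem HasLogGrowth.upper_of_ball {A σ δ R₀ : ℝ} {w : ℂ → ℝ} (hg : HasLogGrowth A σ δ R₀ w)
    (hσ : 0 ≤ σ) {z x : ℂ} (hx : x ∈ Metric.ball z 1) :
    w x ≤ A + σ * Real.log 2 + σ * Real.posLog ‖z‖ := by
  rw [mem_ball_iff_norm] at hx
  have h1 : ‖x‖ ≤ ‖z‖ + 1 := by
    have := norm_add_le (x - z) z
    rw [sub_add_cancel] at this
    linarith
  have h2 := (Real.posLog_le_posLog (norm_nonneg _) h1).trans Real.posLog_add
  rw [Real.posLog_one, add_zero] at h2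
  have := mul_le_mul_of_nonneg_left h2 hσ
  linarith [hg.upper x]

theorem HasLogGrowth.logMollify {A σ δ R₀ : ℝ} (hg : HasLogGrowth A σ δ R₀ w) (hs : SubMean w)
    (hw : Continuous w) (hσ : 0 ≤ σ) (hh : 0 < h) (hh1 : h ≤ 1) :
    HasLogGrowth (A + σ * Real.log 2) σ δ R₀ (logMollify h w) := by
  refine ⟨fun z => logMollify_le hw hh fun x hx =>
    hg.upper_of_ball hσ (Metric.ball_subset_ball hh1 hx), fun S hS => ?_⟩
  obtain ⟨ζ, hζ, hB⟩ := hg.lower S hS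
  have : 0 ≤ σ * Real.log 2 := mul_nonneg hσ (Real.log_nonneg (by norm_num))
  exact ⟨ζ, hζ, by linarith [hs.le_logMollify hw hh ζ]⟩

end

/-- The bound of `exists_uniform_lintegral_exp_le` for all continuous subharmonic functions. -/
theorem exists_uniform_lintegral_exp_le_of_subMean {A σ δ R₀ t : ℝ} (hA : 0 ≤ A) (hσ : 0 ≤ σ)
    (hδ : 0 < δ) (hR₀ : 1 ≤ R₀) (ht : 0 ≤ t) (htδ : t * (77 * δ) ≤ 1)
    (htσ : 2 < t * (σ - 25 * δ)) :
    ∃ R : ℝ, ∃ K : ℝ≥0∞, K < ⊤ ∧ ∀ w : ℂ → ℝ, Continuous w → SubMean w →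
      HasLogGrowth A σ δ R₀ w →
      ∫⁻ z in {z : ℂ | R ≤ ‖z‖}, ENNReal.ofReal (Real.exp (-(t * w z))) ≤ K := by
  have h0 : 0 ≤ σ * Real.log 2 := mul_nonneg hσ (Real.log_nonneg (by norm_num))
  obtain ⟨R, K, hK, H⟩ := exists_uniform_lintegral_exp_le (A := A + σ * Real.log 2) (by positivity)
    hσ hδ hR₀ ht htδ htσ
  refine ⟨R, K, hK, fun w hw hs hg => ?_⟩
  -- `R` and `K` depend only on the growth constants, hence serve all mollifications at once, and
  -- Fatou's lemma applies as the radius tends to `0`.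
  have hd : ∀ n : ℕ, HasRieszDensity (logMollify (1 / ((n : ℝ) + 1)) w) _ := fun n =>
    hs.hasRieszDensity_logMollify hw (by positivity)
  calc ∫⁻ z in {z : ℂ | R ≤ ‖z‖}, ENNReal.ofReal (Real.exp (-(t * w z)))
      = ∫⁻ z in {z : ℂ | R ≤ ‖z‖}, liminf (fun n : ℕ =>
          ENNReal.ofReal (Real.exp (-(t * logMollify (1 / ((n : ℝ) + 1)) w z)))) atTop := by
        congr 1
        ext z
        refine (Tendsto.liminf_eq (ENNReal.tendsto_ofReal ?_)).symm
        exact (Real.continuous_exp.tendsto _).comp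
          (((tendsto_logMollify hs hw z).const_mul t).neg)
    _ ≤ liminf (fun n : ℕ => ∫⁻ z in {z : ℂ | R ≤ ‖z‖},
          ENNReal.ofReal (Real.exp (-(t * logMollify (1 / ((n : ℝ) + 1)) w z)))) atTop := by
        refine lintegral_liminf_le fun n => ?_
        have := (hd n).continuous_fun.measurable
        fun_prop
    _ ≤ K := by
        refine (liminf_le_liminf (Eventually.of_forall fun n =>
          H _ _ (hd n) (hg.logMollify hs hw hσ (by positivity) ?_))).trans_eq (liminf_const K)
        rw [div_le_one (by positivity)]
        have : (0 : ℝ) ≤ n := by positivity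
        linarith

/-! ### Local integrability of subharmonic functions. -/

theorem lintegral_ball_le_of_circle {F : ℂ → ℝ≥0∞} (hF : Measurable F) {z : ℂ} {R : ℝ} {C : ℝ≥0∞}
    (h : ∀ r, 0 < r → r < R → ∫⁻ θ in Set.Ioc 0 (2 * Real.pi), F (circleMap z r θ) ≤ C) :
    ∫⁻ x in Metric.ball z R, F x ≤ ENNReal.ofReal R * (ENNReal.ofReal R * C) := by
  rw [← lintegral_indicator Metric.isOpen_ball.measurableSet, ← lintegral_sub_left_eq_self _ z,
    ← Complex.lintegral_comp_polarCoord_symm]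
  have h1 : ∀ p ∈ polarCoord.target, ENNReal.ofReal p.1 •
      (Metric.ball z R).indicator F (z - Complex.polarCoord.symm p) ≤
      (Set.Ioo 0 R ×ˢ Set.Ioo (-Real.pi) Real.pi).indicator
        (fun p : ℝ × ℝ => ENNReal.ofReal R * F (circleMap z p.1 (p.2 + Real.pi))) p := by
    rintro ⟨r, θ⟩ hp
    simp only [polarCoord_target, Set.mem_prod, Set.mem_Ioi] at hp
    have hn : ‖Complex.polarCoord.symm (r, θ)‖ = r := by
      rw [Complex.norm_polarCoord_symm, abs_of_pos hp.1]
    have he : z - Complex.polarCoord.symm (r, θ) = circleMap z r (θ + Real.pi) := by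
      simp [circleMap, Complex.polarCoord_symm_apply, Complex.exp_mul_I, add_mul, Complex.exp_add]
      ring
    by_cases hr : r < R
    · rw [Set.indicator_of_mem (by simpa [hn, abs_of_pos hp.1] using hr),
        Set.indicator_of_mem (by simp_all), smul_eq_mul, he]
      gcongr
    · rw [Set.indicator_of_notMem (by simpa [hn, abs_of_pos hp.1] using hr), smul_zero]
      exact zero_le
  have hm : Measurable fun p : ℝ × ℝ => ENNReal.ofReal R * F (circleMap z p.1 (p.2 + Real.pi)) :=
    (hF.comp (Continuous.measurable (by unfold circleMap; fun_prop))).const_mul _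
  calc _ ≤ ∫⁻ p in polarCoord.target, (Set.Ioo 0 R ×ˢ Set.Ioo (-Real.pi) Real.pi).indicator
        (fun p : ℝ × ℝ => ENNReal.ofReal R * F (circleMap z p.1 (p.2 + Real.pi))) p :=
        setLIntegral_mono' polarCoord.open_target.measurableSet h1
    _ ≤ ∫⁻ p, (Set.Ioo 0 R ×ˢ Set.Ioo (-Real.pi) Real.pi).indicator
        (fun p : ℝ × ℝ => ENNReal.ofReal R * F (circleMap z p.1 (p.2 + Real.pi))) p :=
        setLIntegral_le_lintegral _ _
    _ = ∫⁻ r in Set.Ioo 0 R, ∫⁻ θ in Set.Ioo (-Real.pi) Real.pi,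
          ENNReal.ofReal R * F (circleMap z r (θ + Real.pi)) := by
        rw [lintegral_indicator (measurableSet_Ioo.prod measurableSet_Ioo), Measure.volume_eq_prod,
          setLIntegral_prod _ hm.aemeasurable]
    _ ≤ ∫⁻ r in Set.Ioo 0 R, ENNReal.ofReal R * C := by
        refine setLIntegral_mono' measurableSet_Ioo fun r hr => ?_
        rw [lintegral_const_mul' _ _ ENNReal.ofReal_ne_top]
        gcongr
        refine le_trans ?_ (h r hr.1 hr.2)
        rw [← lintegral_indicator measurableSet_Ioc, ← lintegral_indicator measurableSet_Ioo,
          ← lintegral_add_right_eq_self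
            ((Set.Ioc 0 (2 * Real.pi)).indicator fun θ => F (circleMap z r θ)) Real.pi]
        refine lintegral_mono fun θ => ?_
        by_cases hθ : θ ∈ Set.Ioo (-Real.pi) Real.pi
        · rw [Set.indicator_of_mem hθ, Set.indicator_of_mem]
          exact ⟨by linarith [hθ.1], by linarith [hθ.2]⟩
        · rw [Set.indicator_of_notMem hθ]; exact zero_le
    _ = _ := by
        rw [setLIntegral_const, Real.volume_Ioo, sub_zero, mul_comm]

/-- Valid also at `⊥` and `⊤`, because every `toReal` involved sends infinite values to `0`. -/
theorem EReal.toReal_eq_toENNReal_sub (x : EReal) :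
    x.toReal = x.toENNReal.toReal - (-x).toENNReal.toReal := by
  induction x with
  | bot => simp
  | top => simp
  | coe x =>
    rw [← EReal.coe_neg, EReal.toReal_coe, EReal.toENNReal_of_ne_top (EReal.coe_ne_top _),
      EReal.toENNReal_of_ne_top (EReal.coe_ne_top _), EReal.toReal_coe, EReal.toReal_coe,
      ENNReal.toReal_ofReal', ENNReal.toReal_ofReal']
    rcases le_total 0 x with h | h
    · rw [max_eq_left h, max_eq_right (by linarith), sub_zero]
    · rw [max_eq_right h, max_eq_left (by linarith)]; ring

theorem coe_ennreal_eq_coe_toReal {a : ℝ≥0∞} (ha : a ≠ ⊤) : (a : EReal) = ((a.toReal : ℝ) : EReal) := by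
  conv_lhs => rw [← ENNReal.ofReal_toReal ha]
  rw [EReal.coe_ennreal_ofReal, max_eq_left ENNReal.toReal_nonneg]

namespace IsSubharmonic

variable {u : ℂ → EReal}

theorem measurable (hu : IsSubharmonic u) : Measurable u := hu.upperSemicontinuous.measurable

theorem exists_le_of_closedBall (hu : IsSubharmonic u) (z : ℂ) (R : ℝ) :
    ∃ M : ℝ, 0 ≤ M ∧ ∀ x ∈ Metric.closedBall z R, u x ≤ M := by
  rcases lt_or_ge R 0 with hR | hR
  · exact ⟨0, le_rfl, by simp [Metric.closedBall_eq_empty.2 hR]⟩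
  obtain ⟨a, -, ha⟩ := UpperSemicontinuousOn.exists_isMaxOn (Metric.nonempty_closedBall.2 hR)
    (isCompact_closedBall z R) (hu.upperSemicontinuous.upperSemicontinuousOn _)
  refine ⟨max 0 (u a).toReal, le_max_left _ _, fun x hx => (ha hx).trans ?_⟩
  refine (EReal.le_coe_toReal (hu.lt_top a).ne).trans ?_
  exact_mod_cast le_max_right _ _

/-- A finite value at the centre and an upper bound on the circle force the negative part to have
finite integral. Then the extended mean is an ordinary one, and the bound on the negative part is
uniform in `r`, as needed for integration over discs. -/
theorem circle_aux (hu : IsSubharmonic u) {z : ℂ} (hz : u z ≠ ⊥) {r : ℝ} (hr : 0 < r) :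
    (CircleIntegrable (fun x => (u x).toReal) z r ∧
      (u z).toReal ≤ Real.circleAverage (fun x => (u x).toReal) z r) ∧
    ∀ M : ℝ, 0 ≤ M → (∀ x ∈ Metric.closedBall z r, u x ≤ M) →
      ∫⁻ θ in Set.Ioc 0 (2 * Real.pi), (-u (circleMap z r θ)).toENNReal ≤
        ENNReal.ofReal (2 * Real.pi * (M - (u z).toReal)) := by
  have hm := hu.measurable
  set P : ℝ≥0∞ := ∫⁻ θ in Set.Ioc 0 (2 * Real.pi), (u (circleMap z r θ)).toENNReal with hP
  set N : ℝ≥0∞ := ∫⁻ θ in Set.Ioc 0 (2 * Real.pi), (-u (circleMap z r θ)).toENNReal with hN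
  have hcm : Measurable (circleMap z r) := (continuous_circleMap z r).measurable
  have hPm : Measurable fun θ => (u (circleMap z r θ)).toENNReal := (hm.comp hcm).ereal_toENNReal
  have hNm : Measurable fun θ => (-u (circleMap z r θ)).toENNReal :=
    (measurable_neg.comp (hm.comp hcm)).ereal_toENNReal
  have hPle : ∀ M : ℝ, 0 ≤ M → (∀ x ∈ Metric.closedBall z r, u x ≤ M) →
      P ≤ ENNReal.ofReal (2 * Real.pi * M) := by
    intro M hM hb
    calc P ≤ ∫⁻ θ in Set.Ioc 0 (2 * Real.pi), ENNReal.ofReal M := by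
          refine lintegral_mono fun θ => ?_
          have := EReal.toENNReal_le_toENNReal (hb _ (circleMap_mem_closedBall z hr.le θ))
          rwa [EReal.toENNReal_of_ne_top (EReal.coe_ne_top _), EReal.toReal_coe] at this
      _ = _ := by
          rw [setLIntegral_const, Real.volume_Ioc, sub_zero, ← ENNReal.ofReal_mul hM, mul_comm]
  obtain ⟨M₀, hM₀, hb₀⟩ := hu.exists_le_of_closedBall z r
  have hPt : P ≠ ⊤ := ((hPle M₀ hM₀ hb₀).trans_lt ENNReal.ofReal_lt_top).ne
  have hpi : (0 : ℝ) < (2 * Real.pi)⁻¹ := inv_pos.2 Real.two_pi_pos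
  have hle := hu.le_circleMean z r hr
  have hmean : circleMean u z r = (((2 * Real.pi)⁻¹ : ℝ) : EReal) * ((P : EReal) - (N : EReal)) := rfl
  rw [hmean] at hle
  have hNt : N ≠ ⊤ := by
    intro h
    rw [h, EReal.coe_ennreal_top, EReal.sub_top, EReal.coe_mul_bot_of_pos hpi, le_bot_iff] at hle
    exact hz hle
  have hreal : (u z).toReal ≤ (2 * Real.pi)⁻¹ * (P.toReal - N.toReal) := by
    rw [coe_ennreal_eq_coe_toReal hPt, coe_ennreal_eq_coe_toReal hNt, ← EReal.coe_sub,
      ← EReal.coe_mul, ← EReal.coe_toReal (hu.lt_top z).ne hz] at hle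
    exact EReal.coe_le_coe_iff.1 hle
  have hiP := integrable_toReal_of_lintegral_ne_top hPm.aemeasurable hPt
  have hiN := integrable_toReal_of_lintegral_ne_top hNm.aemeasurable hNt
  refine ⟨⟨?_, ?_⟩, fun M hM hb => ?_⟩
  · rw [CircleIntegrable, intervalIntegrable_iff_integrableOn_Ioc_of_le Real.two_pi_pos.le]
    refine (hiP.sub hiN).congr (ae_of_all _ fun θ => ?_)
    exact (EReal.toReal_eq_toENNReal_sub _).symm
  · rw [circleAverage_eq_setIntegral]
    simp only [EReal.toReal_eq_toENNReal_sub (u (circleMap z r _))]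
    rw [integral_sub hiP hiN, integral_toReal hPm.aemeasurable (ae_lt_top hPm hPt),
      integral_toReal hNm.aemeasurable (ae_lt_top hNm hNt)]
    exact hreal
  · rw [← ENNReal.ofReal_toReal hNt]
    refine ENNReal.ofReal_le_ofReal ?_
    have h1 : P.toReal ≤ 2 * Real.pi * M :=
      ENNReal.toReal_le_of_le_ofReal (by positivity) (hPle M hM hb)
    rw [le_inv_mul_iff₀ Real.two_pi_pos] at hreal
    linarith

theorem lintegral_neg_ball_lt_top (hu : IsSubharmonic u) (R : ℝ) :
    ∫⁻ x in Metric.ball 0 R, (-u x).toENNReal < ⊤ := by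
  obtain ⟨z, hz⟩ := hu.ne_bot
  obtain ⟨M, hM, hb⟩ := hu.exists_le_of_closedBall z (R + ‖z‖)
  have h1 : ∫⁻ x in Metric.ball z (R + ‖z‖), (-u x).toENNReal ≤ _ :=
    lintegral_ball_le_of_circle (F := fun x => (-u x).toENNReal)
      (measurable_neg.comp hu.measurable).ereal_toENNReal fun r h0 h1 =>
      (hu.circle_aux hz h0).2 M hM fun x hx => hb x (Metric.closedBall_subset_closedBall h1.le hx)
  refine (lintegral_mono_set (Metric.ball_subset_ball' ?_)).trans_lt (h1.trans_lt ?_)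
  · rw [dist_zero_left]
  · finiteness

theorem ae_ne_bot (hu : IsSubharmonic u) : ∀ᵐ x, u x ≠ ⊥ := by
  have h : ∀ n : ℕ, ∀ᵐ x, x ∈ Metric.ball (0 : ℂ) n → u x ≠ ⊥ := fun n => by
    have := ae_lt_top (measurable_neg.comp hu.measurable).ereal_toENNReal
      (hu.lintegral_neg_ball_lt_top n).ne
    filter_upwards [(ae_restrict_iff' Metric.isOpen_ball.measurableSet).1 this] with x hx hxn h0
    have := hx hxn
    simp [h0] at this
  filter_upwards [ae_all_iff.2 h] with x hx
  obtain ⟨n, hn⟩ := exists_nat_gt ‖x‖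
  exact hx n (by simpa using hn)

theorem measurable_toReal (hu : IsSubharmonic u) : Measurable fun x => (u x).toReal :=
  hu.measurable.ereal_toReal

theorem locallyIntegrable_toReal (hu : IsSubharmonic u) :
    LocallyIntegrable fun x => (u x).toReal := by
  intro x
  refine ⟨Metric.ball 0 (‖x‖ + 1), Metric.isOpen_ball.mem_nhds (by simp), ?_⟩
  obtain ⟨M, hM, hb⟩ := hu.exists_le_of_closedBall 0 (‖x‖ + 1)
  have hi := integrable_toReal_of_lintegral_ne_top
    ((measurable_neg.comp hu.measurable).ereal_toENNReal.aemeasurable)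
    (hu.lintegral_neg_ball_lt_top (‖x‖ + 1)).ne
  refine Integrable.mono' ((integrableOn_const (C := M) (by finiteness)).add hi)
    hu.measurable_toReal.aestronglyMeasurable
    ((ae_restrict_iff' Metric.isOpen_ball.measurableSet).2 (ae_of_all _ fun y hy => ?_))
  have h1 := EReal.toENNReal_le_toENNReal (hb y (Metric.ball_subset_closedBall hy))
  rw [EReal.toENNReal_of_ne_top (EReal.coe_ne_top M), EReal.toReal_coe] at h1
  have h2 := ENNReal.toReal_le_of_le_ofReal hM h1
  have h3 : 0 ≤ (u y).toENNReal.toReal := ENNReal.toReal_nonneg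
  have h4 : 0 ≤ (-u y).toENNReal.toReal := ENNReal.toReal_nonneg
  rw [EReal.toReal_eq_toENNReal_sub, Real.norm_eq_abs]
  simp only [Pi.add_apply, Function.comp_apply]
  rw [abs_le]
  constructor <;> linarith

end IsSubharmonic

/-! ### Continuous subharmonic majorants by tent averages. -/

/-- The tent function of radius `h`. -/
noncomputable def tent (h : ℝ) (y : ℂ) : ℝ := max 0 (h - ‖y‖)

theorem tent_nonneg (h : ℝ) (y : ℂ) : 0 ≤ tent h y := le_max_left _ _

theorem tent_eq_zero {h : ℝ} {y : ℂ} (hy : h ≤ ‖y‖) : tent h y = 0 := max_eq_left (by linarith)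

theorem continuous_tent (h : ℝ) : Continuous (tent h) := by unfold tent; fun_prop

theorem hasCompactSupport_tent (h : ℝ) : HasCompactSupport (tent h) :=
  HasCompactSupport.intro (isCompact_closedBall 0 h) fun y hy => tent_eq_zero (by
    simp only [mem_closedBall_zero_iff, not_le] at hy
    exact hy.le)

theorem integrable_tent (h : ℝ) : Integrable (tent h) :=
  (continuous_tent h).integrable_of_hasCompactSupport (hasCompactSupport_tent h)

theorem integral_tent_pos {h : ℝ} (hh : 0 < h) : 0 < ∫ y, tent h y :=
  (continuous_tent h).integral_pos_of_hasCompactSupport_nonneg_nonzero (hasCompactSupport_tent h)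
    (tent_nonneg h) (x := 0) (by simp [tent, hh.le, hh.ne'])

/-- The average of `u` against the normalized tent function of radius `h`. -/
noncomputable def tentMollify (h : ℝ) (u : ℂ → EReal) (z : ℂ) : ℝ :=
  (∫ y, tent h y)⁻¹ * ∫ y, tent h y * (u (z - y)).toReal

namespace IsSubharmonic

variable {u : ℂ → EReal} {h : ℝ}

theorem integrable_tent_mul (hu : IsSubharmonic u) (h : ℝ) (z : ℂ) :
    Integrable fun y => tent h y * (u (z - y)).toReal := by
  have := (integrable_kernel_mul hu.locallyIntegrable_toReal (continuous_tent h)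
    (hasCompactSupport_tent h) z).comp_sub_left z
  simpa [mul_comm] using this

theorem continuous_tentMollify (hu : IsSubharmonic u) (h : ℝ) : Continuous (tentMollify h u) :=
  ((hasCompactSupport_tent h).continuous_convolution_left (ContinuousLinearMap.mul ℝ ℝ)
    (continuous_tent h) hu.locallyIntegrable_toReal).const_smul (∫ y, tent h y)⁻¹

theorem tentMollify_le (hu : IsSubharmonic u) (hh : 0 < h) {z : ℂ} {B : ℝ}
    (hB : ∀ x ∈ Metric.ball z h, u x ≤ B) : tentMollify h u z ≤ B := by
  rw [tentMollify, inv_mul_le_iff₀ (integral_tent_pos hh), mul_comm]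
  refine integral_kernel_mul_le (f := fun x => (u x).toReal) (tent_nonneg h) (integrable_tent h)
    (fun y hy => tent_eq_zero hy) (hu.integrable_tent_mul h z) ?_
  filter_upwards [hu.ae_ne_bot] with x hx hxb
  exact EReal.toReal_le_toReal (hB x hxb) hx (EReal.coe_ne_top B)

theorem le_tentMollify (hu : IsSubharmonic u) (hh : 0 < h) (z : ℂ) :
    u z ≤ (tentMollify h u z : ℝ) := by
  rcases eq_or_ne (u z) ⊥ with hz | hz
  · rw [hz]; exact bot_le
  rw [← EReal.coe_toReal (hu.lt_top z).ne hz, EReal.coe_le_coe_iff, tentMollify,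
    le_inv_mul_iff₀ (integral_tent_pos hh), mul_comm]
  exact const_mul_integral_radial_le (k := fun r => max 0 (h - r)) (f := fun x => (u x).toReal)
    (fun r _ => le_max_left _ _) (integrable_tent h) (hu.integrable_tent_mul h z)
    fun r hr _ => (hu.circle_aux hz hr).1

/-- By Fubini the circle average can be taken on translates of `u` under the tent. The sub-mean
inequality for `toReal` is available where `u ≠ ⊥`, that is almost everywhere. -/
theorem subMean_tentMollify (hu : IsSubharmonic u) (hh : 0 < h) : SubMean (tentMollify h u) := by
  intro z r hr
  have e : ∀ x, ∫ y, tent h y * (u (x - y)).toReal = ∫ y, (u y).toReal * tent h (x - y) := fun x => by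
    rw [← integral_sub_left_eq_self _ _ x]
    simp [mul_comm]
  have h1 : Real.circleAverage (tentMollify h u) z r = (∫ y, tent h y)⁻¹ *
      Real.circleAverage (fun x => ∫ y, (u y).toReal * tent h (x - y)) z r := by
    rw [← smul_eq_mul, ← Real.circleAverage_fun_smul]
    simp only [← e]
    rfl
  rw [h1, circleAverage_convolution' hu.measurable_toReal hu.locallyIntegrable_toReal
    (continuous_tent h) (hasCompactSupport_tent h), tentMollify]
  refine mul_le_mul_of_nonneg_left ?_ (inv_nonneg.2 (integral_tent_pos hh).le)
  refine integral_mono_ae (hu.integrable_tent_mul h z) (integrable_circleAverage_mul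
    hu.measurable_toReal hu.locallyIntegrable_toReal (continuous_tent h)
    (hasCompactSupport_tent h) z r) ?_
  filter_upwards [(Measure.measurePreserving_sub_left volume z).quasiMeasurePreserving.ae
    hu.ae_ne_bot] with y hy
  rw [mul_comm]
  exact mul_le_mul_of_nonneg_right (hu.circle_aux hy hr).1.2 (tent_nonneg h y)

theorem eventually_tentMollify_le (hu : IsSubharmonic u) {z : ℂ} {b : ℝ} (hb : u z < b) :
    ∀ᶠ n : ℕ in atTop, tentMollify (1 / ((n : ℝ) + 1)) u z ≤ b := by
  obtain ⟨r, hr, hball⟩ := Metric.mem_nhds_iff.1 (hu.upperSemicontinuous z b hb)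
  filter_upwards [(tendsto_one_div_add_atTop_nhds_zero_nat (𝕜 := ℝ)).eventually_lt_const hr]
    with n hn
  refine hu.tentMollify_le (by positivity) fun x hx => ?_
  have : x ∈ Metric.ball z r := Metric.ball_subset_ball hn.le hx
  exact (hball this).le

/-- Upper semicontinuity makes `{u < a}` open, and compactness gives it a uniform neighbourhood of
the sphere. Boundary bounds thus pass to the continuous majorants. -/
theorem exists_tentMollify_le_on_sphere (hu : IsSubharmonic u) {z₀ : ℂ} {ρ a : ℝ}
    (ha : ∀ z, ‖z - z₀‖ = ρ → u z < a) :
    ∃ ε > 0, ∀ h, 0 < h → h ≤ ε → ∀ z, ‖z - z₀‖ = ρ → tentMollify h u z ≤ a := by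
  obtain ⟨ε, hε, hsub⟩ := (isCompact_sphere z₀ ρ).exists_thickening_subset_open
    (hu.upperSemicontinuous.isOpen_preimage (a : EReal))
    (fun z hz => ha z (by simpa [dist_eq_norm] using hz))
  refine ⟨ε, hε, fun h hh hle z hz => hu.tentMollify_le hh fun x hx => ?_⟩
  have : x ∈ Metric.thickening ε (Metric.sphere z₀ ρ) :=
    Metric.mem_thickening_iff.2 ⟨z, by simpa [dist_eq_norm] using hz,
      (Metric.mem_ball.1 hx).trans_le hle⟩
  exact (hsub this).le

/-- Three circles theorem for subharmonic functions. -/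
theorem three_circles (hu : IsSubharmonic u) {z₀ : ℂ} {ρ S a b : ℝ} (hρ : 0 < ρ)
    (h1 : ∀ z, ‖z - z₀‖ = ρ → u z < a)
    (h2 : ∀ z, ‖z - z₀‖ = S → u z < ((a + b * Real.log (S / ρ) : ℝ) : EReal)) {z : ℂ}
    (hz : ρ ≤ ‖z - z₀‖) (hz' : ‖z - z₀‖ ≤ S) :
    u z ≤ ((a + b * Real.log (‖z - z₀‖ / ρ) : ℝ) : EReal) := by
  obtain ⟨ε₁, hε₁, H1⟩ := hu.exists_tentMollify_le_on_sphere h1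
  obtain ⟨ε₂, hε₂, H2⟩ := hu.exists_tentMollify_le_on_sphere h2
  have hh : 0 < min ε₁ ε₂ := lt_min hε₁ hε₂
  refine (hu.le_tentMollify hh z).trans (EReal.coe_le_coe_iff.2 ?_)
  exact (hu.subMean_tentMollify hh).three_circles (hu.continuous_tentMollify _) hρ
    (H1 _ hh (min_le_left _ _)) (H2 _ hh (min_le_right _ _)) hz hz'

end IsSubharmonic

/-! ### The weights and failure of integrability. -/

theorem expNegMul_antitone {c : ℝ} (hc : 0 ≤ c) {u v : ℂ → EReal} {z : ℂ} (h : u z ≤ v z) :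
    expNegMul c v z ≤ expNegMul c u z := by
  refine EReal.exp_monotone (EReal.neg_le_neg_iff.2 ?_)
  exact mul_le_mul_of_nonneg_left h (by exact_mod_cast hc)

theorem expNegMul_sq_of_eq_coe {c b : ℝ} {u : ℂ → EReal} {z : ℂ} (h : u z = b) :
    expNegMul c u z ^ 2 = ENNReal.ofReal (Real.exp (-(2 * c * b))) := by
  rw [expNegMul, h, ← EReal.coe_mul, ← EReal.coe_neg, EReal.exp_coe,
    ← ENNReal.ofReal_pow (Real.exp_pos _).le, ← Real.exp_nat_mul]
  congr 2
  push_cast; ring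

theorem le_expNegMul_sq {c : ℝ} (hc : 0 ≤ c) {b : ℝ} {u : ℂ → EReal} {z : ℂ} (h : u z ≤ b) :
    ENNReal.ofReal (Real.exp (-(2 * c * b))) ≤ expNegMul c u z ^ 2 := by
  rw [← expNegMul_sq_of_eq_coe (u := fun _ => (b : EReal)) (z := z) rfl]
  exact pow_le_pow_left₀ zero_le (expNegMul_antitone hc (v := fun _ => (b : EReal)) h) 2

/-- Tests the weight through real numbers above `u z`, which treats the points with `u z = ⊥`
together with the others; the Fatou argument uses it in this form. -/
theorem expNegMul_sq_le {c : ℝ} (hc : 0 < c) {u : ℂ → EReal} {z : ℂ} {l : ℝ≥0∞}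
    (h : ∀ b : ℝ, u z < b → ENNReal.ofReal (Real.exp (-(2 * c * b))) ≤ l) (ht : u z ≠ ⊤) :
    expNegMul c u z ^ 2 ≤ l := by
  rcases eq_or_ne l ⊤ with rfl | hl
  · exact le_top
  have hl0 : 0 < l.toReal := by
    obtain ⟨b, hb, -⟩ := EReal.lt_iff_exists_real_btwn.1 (lt_top_iff_ne_top.2 ht)
    refine ENNReal.toReal_pos (fun h0 => ?_) hl
    have := h b hb
    rw [h0, nonpos_iff_eq_zero, ENNReal.ofReal_eq_zero] at this
    exact absurd this (not_le.2 (Real.exp_pos _))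
  set b₀ : ℝ := -(Real.log l.toReal / (2 * c)) with hb₀
  have hle : (b₀ : EReal) ≤ u z := by
    refine EReal.le_of_forall_lt_iff_le.1 fun b hb => ?_
    have h1 := ENNReal.toReal_mono hl (h b hb)
    rw [ENNReal.toReal_ofReal (Real.exp_pos _).le, ← Real.le_log_iff_exp_le hl0] at h1
    rw [EReal.coe_le_coe_iff, hb₀, neg_le, le_div_iff₀ (by positivity)]
    linarith
  calc expNegMul c u z ^ 2 ≤ expNegMul c (fun _ => (b₀ : EReal)) z ^ 2 :=
        pow_le_pow_left₀ zero_le (expNegMul_antitone hc.le hle) 2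
    _ = l := by
        rw [expNegMul_sq_of_eq_coe (b := b₀) rfl, hb₀,
          show -(2 * c * -(Real.log l.toReal / (2 * c))) = Real.log l.toReal by field_simp,
          Real.exp_log hl0, ENNReal.ofReal_toReal hl]

theorem measurable_expNegMul {c : ℝ} {u : ℂ → EReal} (hu : Measurable u) :
    Measurable (expNegMul c u) :=
  EReal.exp_monotone.measurable.comp (measurable_neg.comp (hu.const_mul _))

theorem lintegral_inv_norm_sq_eq_top (R : ℝ) :
    ∫⁻ z in {z : ℂ | R < ‖z‖}, ENNReal.ofReal ((‖z‖ ^ 2)⁻¹) = ⊤ := by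
  have hs : MeasurableSet {z : ℂ | R < ‖z‖} := measurableSet_lt measurable_const measurable_norm
  rw [← lintegral_indicator hs, ← Complex.lintegral_comp_polarCoord_symm]
  set T := max R 0
  have h1 : ∀ p ∈ polarCoord.target,
      (Set.Ioi T ×ˢ Set.Ioo (-Real.pi) Real.pi).indicator
        (fun p : ℝ × ℝ => ENNReal.ofReal p.1⁻¹) p ≤ ENNReal.ofReal p.1 •
      {z : ℂ | R < ‖z‖}.indicator (fun z => ENNReal.ofReal ((‖z‖ ^ 2)⁻¹))
        (Complex.polarCoord.symm p) := by
    rintro ⟨r, θ⟩ hp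
    simp only [polarCoord_target, Set.mem_prod, Set.mem_Ioi] at hp
    have hn : ‖Complex.polarCoord.symm (r, θ)‖ = r := by
      rw [Complex.norm_polarCoord_symm, abs_of_pos hp.1]
    by_cases hr : T < r
    · rw [Set.indicator_of_mem (by simp_all), Set.indicator_of_mem, hn, smul_eq_mul,
        ← ENNReal.ofReal_mul hp.1.le]
      · refine le_of_eq ?_
        congr 1
        have := hp.1.ne'
        field_simp
      · simp only [Set.mem_ofPred_eq, hn]
        exact (le_max_left _ _).trans_lt hr
    · rw [Set.indicator_of_notMem (by simp_all)]; exact zero_le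
  have hT : Set.Ioi T ×ˢ Set.Ioo (-Real.pi) Real.pi ⊆ polarCoord.target := by
    rw [polarCoord_target]
    exact Set.prod_mono (Set.Ioi_subset_Ioi (le_max_right _ _)) subset_rfl
  have hinf : ∫⁻ r in Set.Ioi T, ENNReal.ofReal r⁻¹ = ⊤ := by
    by_contra hne
    refine not_integrableOn_Ioi_inv (a := T) ⟨by fun_prop, ?_⟩
    rw [hasFiniteIntegral_iff_ofReal]
    · exact lt_top_iff_ne_top.2 hne
    · refine (ae_restrict_iff' measurableSet_Ioi).2 (ae_of_all _ fun r hr => ?_)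
      exact inv_nonneg.2 ((le_max_right R 0).trans (le_of_lt hr))
  refine top_le_iff.1 (le_trans (le_of_eq ?_)
    (setLIntegral_mono' polarCoord.open_target.measurableSet h1))
  rw [setLIntegral_indicator (measurableSet_Ioi.prod measurableSet_Ioo),
    Set.inter_eq_left.2 hT, Measure.volume_eq_prod, setLIntegral_prod _ (by fun_prop)]
  simp only [setLIntegral_const]
  rw [lintegral_mul_const _ (by fun_prop), hinf, ENNReal.top_mul]
  rw [Real.volume_Ioo]
  simp [Real.pi_pos]

theorem not_isL2AtInfty_expNegMul {v : ℂ → EReal} {A s c : ℝ} (hc : 0 ≤ c) (hcs : c * s ≤ 1)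
    (hv : ∀ z, 1 ≤ ‖z‖ → v z ≤ ((A + s * Real.log ‖z‖ : ℝ) : EReal)) :
    ¬ IsL2AtInfty (expNegMul c v) := by
  rintro ⟨-, K, hK, hfin⟩
  obtain ⟨R, hR⟩ := hK.isBounded.subset_closedBall 0
  refine hfin.ne (top_le_iff.1 ?_)
  have hsub : {z : ℂ | max R 1 < ‖z‖} ⊆ Kᶜ := fun z hz hzK => by
    have h1 := hR hzK
    rw [mem_closedBall_zero_iff] at h1
    exact absurd h1 (not_le.2 ((le_max_left _ _).trans_lt hz))
  have hs : MeasurableSet {z : ℂ | max R 1 < ‖z‖} :=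
    measurableSet_lt measurable_const measurable_norm
  calc (⊤ : ℝ≥0∞) = ENNReal.ofReal (Real.exp (-(2 * c * A))) *
        ∫⁻ z in {z : ℂ | max R 1 < ‖z‖}, ENNReal.ofReal ((‖z‖ ^ 2)⁻¹) := by
        rw [lintegral_inv_norm_sq_eq_top, ENNReal.mul_top]
        simp [Real.exp_pos]
    _ = ∫⁻ z in {z : ℂ | max R 1 < ‖z‖}, ENNReal.ofReal (Real.exp (-(2 * c * A))) *
          ENNReal.ofReal ((‖z‖ ^ 2)⁻¹) := (lintegral_const_mul' _ _ ENNReal.ofReal_ne_top).symm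
    _ ≤ ∫⁻ z in {z : ℂ | max R 1 < ‖z‖}, expNegMul c v z ^ 2 := by
        refine setLIntegral_mono' hs fun z hz => ?_
        have hz1 : 1 < ‖z‖ := (le_max_right _ _).trans_lt hz
        refine le_trans ?_ (le_expNegMul_sq hc (hv z hz1.le))
        rw [← ENNReal.ofReal_mul (Real.exp_pos _).le]
        refine ENNReal.ofReal_le_ofReal ?_
        have e : (‖z‖ ^ 2)⁻¹ = Real.exp (-(2 * Real.log ‖z‖)) := by
          rw [Real.exp_neg, mul_comm, Real.exp_mul, Real.exp_log (by linarith)]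
          norm_cast
        rw [e, ← Real.exp_add, Real.exp_le_exp]
        have := mul_le_mul_of_nonneg_right hcs (Real.log_pos hz1).le
        linarith
    _ ≤ ∫⁻ z in Kᶜ, expNegMul c v z ^ 2 := lintegral_mono_set hsub

/-! ### Logarithmic type, Liouville's theorem and growth bounds. -/

theorem exists_le_mul_log_of_logType_lt {u : ℂ → EReal} {b : ℝ} (hb : logType u < b) :
    ∃ R : ℝ, 1 < R ∧ ∀ z, R ≤ ‖z‖ → u z ≤ ((b * Real.log ‖z‖ : ℝ) : EReal) := by
  have h := eventually_lt_of_limsup_lt hb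
  obtain ⟨R, -, hR⟩ := hasBasis_cobounded_norm.eventually_iff.1 h
  refine ⟨max R 2, lt_of_lt_of_le (by norm_num) (le_max_right _ _), fun z hz => ?_⟩
  have h1 := hR (x := z) ((le_max_left _ _).trans hz)
  have h2 : 0 < Real.log ‖z‖ :=
    Real.log_pos (lt_of_lt_of_le (by norm_num) ((le_max_right R 2).trans hz))
  rw [EReal.div_lt_iff (by exact_mod_cast h2) (EReal.coe_ne_top _)] at h1
  rw [EReal.coe_mul]
  exact h1.le

theorem logType_le_of_le {u : ℂ → EReal} {C b R : ℝ}
    (h : ∀ z, R ≤ ‖z‖ → u z ≤ ((C + b * Real.log ‖z‖ : ℝ) : EReal)) : logType u ≤ b := by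
  refine EReal.le_of_forall_lt_iff_le.1 fun b' hb' => ?_
  have hb : 0 < b' - b := sub_pos.2 (EReal.coe_lt_coe_iff.1 hb')
  refine limsup_le_of_le (by isBoundedDefault) ?_
  refine hasBasis_cobounded_norm.eventually_iff.2
    ⟨max R (max 2 (Real.exp (C / (b' - b)))), trivial, fun z hz => ?_⟩
  have hz' : max R (max 2 (Real.exp (C / (b' - b)))) ≤ ‖z‖ := hz
  have hz1 : R ≤ ‖z‖ := (le_max_left _ _).trans hz'
  have hz2 : 2 ≤ ‖z‖ := (le_max_left _ _).trans ((le_max_right _ _).trans hz')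
  have hz3 : Real.exp (C / (b' - b)) ≤ ‖z‖ := (le_max_right _ _).trans ((le_max_right _ _).trans hz')
  have h2 : 0 < Real.log ‖z‖ := Real.log_pos (by linarith)
  rw [EReal.div_le_iff_le_mul (by exact_mod_cast h2) (EReal.coe_ne_top _), ← EReal.coe_mul]
  refine (h z hz1).trans (EReal.coe_le_coe_iff.2 ?_)
  rw [← Real.le_log_iff_exp_le (by linarith), div_le_iff₀ hb] at hz3
  linarith

theorem logType_const (a : ℝ) : logType (fun _ => (a : EReal)) = 0 := by
  refine le_antisymm ?_ ?_
  · have := logType_le_of_le (u := fun _ => (a : EReal)) (C := a) (b := 0) (R := 0) fun z _ => by simp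
    simpa using this
  · by_contra! hlt
    obtain ⟨b, hb, hb0⟩ := EReal.lt_iff_exists_real_btwn.1 hlt
    obtain ⟨R, hR, h⟩ := exists_le_mul_log_of_logType_lt hb
    have hb0' : b < 0 := by exact_mod_cast hb0
    set x : ℝ := max R (Real.exp ((a - 1) / b)) with hx
    have hx0 : R ≤ x := le_max_left _ _
    have h1 := h (x : ℂ) (by rw [Complex.norm_real, Real.norm_of_nonneg (by linarith)]; exact hx0)
    rw [Complex.norm_real, Real.norm_of_nonneg (by linarith), EReal.coe_le_coe_iff] at h1
    have h2 : Real.exp ((a - 1) / b) ≤ x := le_max_right _ _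
    rw [← Real.le_log_iff_exp_le (by linarith), div_le_iff_of_neg hb0'] at h2
    linarith

namespace IsSubharmonic

variable {u : ℂ → EReal}

/-- Liouville's theorem for subharmonic functions of logarithmic type at most `0`. -/
theorem le_of_logType_nonpos (hu : IsSubharmonic u) (h0 : logType u ≤ 0) (z z₀ : ℂ) :
    u z ≤ u z₀ := by
  refine EReal.le_of_forall_lt_iff_le.1 fun a ha => ?_
  obtain ⟨r, hr, hball⟩ := Metric.mem_nhds_iff.1 (hu.upperSemicontinuous z₀ a ha)
  set ρ := r / 2 with hρ
  have hρ0 : 0 < ρ := by positivity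
  have hlt : ∀ x, ‖x - z₀‖ ≤ ρ → u x < a := fun x hx =>
    hball (show x ∈ Metric.ball z₀ r by rw [mem_ball_iff_norm]; linarith)
  rcases le_total ‖z - z₀‖ ρ with hz | hz
  · exact (hlt z hz).le
  have key : ∀ b > 0, u z ≤ ((a + b * Real.log (‖z - z₀‖ / ρ) : ℝ) : EReal) := by
    intro b hb
    obtain ⟨R, hR, hgrow⟩ := exists_le_mul_log_of_logType_lt (u := u) (b := b / 2)
      (h0.trans_lt (by exact_mod_cast half_pos hb))
    -- Large `log S` makes `(b/2) log(2S)` smaller than `a + b log(S/ρ)`; the summand `1` gives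
    -- strictness.
    set E : ℝ := (b / 2 * Real.log 2 + b * Real.log ρ - a + 1) / (b / 2)
    obtain ⟨S, hS⟩ := exists_ge_ge (max (‖z - z₀‖) (R + ‖z₀‖)) (Real.exp E)
    have hS1 : ‖z - z₀‖ ≤ S := (le_max_left _ _).trans hS.1
    have hS2 : R + ‖z₀‖ ≤ S := (le_max_right _ _).trans hS.1
    have hSpos : 0 < S := by linarith [norm_nonneg z₀]
    refine hu.three_circles hρ0 (fun x hx => hlt x hx.le) (fun x hx => ?_) hz hS1
    have e1 : ‖x‖ ≤ ‖x - z₀‖ + ‖z₀‖ := by simpa using norm_add_le (x - z₀) z₀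
    have e2 : ‖x - z₀‖ ≤ ‖x‖ + ‖z₀‖ := norm_sub_le _ _
    refine (hgrow x (by linarith)).trans_lt (EReal.coe_lt_coe_iff.2 ?_)
    have e3 : Real.log ‖x‖ ≤ Real.log (2 * S) :=
      Real.log_le_log (by linarith) (by linarith)
    rw [Real.log_mul two_ne_zero hSpos.ne'] at e3
    rw [Real.log_div hSpos.ne' hρ0.ne']
    have e4 := hS.2
    rw [← Real.le_log_iff_exp_le hSpos, div_le_iff₀ (by positivity)] at e4
    nlinarith
  have hlim : Tendsto (fun b : ℝ => ((a + b * Real.log (‖z - z₀‖ / ρ) : ℝ) : EReal))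
      (nhdsWithin 0 (Set.Ioi 0)) (nhds ((a + 0 * Real.log (‖z - z₀‖ / ρ) : ℝ) : EReal)) := by
    apply Tendsto.mono_left _ nhdsWithin_le_nhds
    apply Continuous.tendsto
    exact continuous_coe_real_ereal.comp (by fun_prop)
  have := ge_of_tendsto hlim (eventually_nhdsWithin_of_forall key)
  simpa using this

/-- A subharmonic function of logarithmic type `σ` is at most `σ log⁺ |z| + O(1)`. -/
theorem exists_le_add_mul_posLog (hu : IsSubharmonic u) {σ : ℝ} (hσ : 0 ≤ σ)
    (h : logType u = σ) :
    ∃ A : ℝ, 0 < A ∧ (∀ z, ‖z‖ ≤ 1 → u z < A) ∧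
      ∀ z, u z ≤ ((A + σ * Real.posLog ‖z‖ : ℝ) : EReal) := by
  obtain ⟨M, hM, hb⟩ := hu.exists_le_of_closedBall 0 1
  have hin : ∀ z : ℂ, ‖z‖ ≤ 1 → u z < ((M + 1 : ℝ) : EReal) := fun z hz =>
    (hb z (by simpa using hz)).trans_lt (EReal.coe_lt_coe_iff.2 (by linarith))
  refine ⟨M + 1, by positivity, hin, fun z => ?_⟩
  rcases le_total ‖z‖ 1 with hz | hz
  · refine (hin z hz).le.trans (EReal.coe_le_coe_iff.2 ?_)
    have := mul_nonneg hσ (Real.posLog_nonneg (x := ‖z‖))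
    linarith
  rw [Real.posLog_eq_log (by simpa using hz)]
  have key : ∀ b > σ, u z ≤ ((M + 1 + b * Real.log ‖z‖ : ℝ) : EReal) := by
    intro b hb
    obtain ⟨R, hR, hgrow⟩ := exists_le_mul_log_of_logType_lt (u := u) (b := b)
      (by rw [h]; exact_mod_cast hb)
    have := hu.three_circles (z₀ := 0) (ρ := 1) (S := max R ‖z‖) (a := M + 1) (b := b) one_pos
      (fun x hx => hin x (by simpa using hx.le)) (fun x hx => ?_) (z := z) (by simpa using hz)
      (by simp)
    · simpa using this
    · rw [sub_zero] at hx
      refine (hgrow x (by rw [hx]; exact le_max_left _ _)).trans_lt (EReal.coe_lt_coe_iff.2 ?_)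
      rw [hx, div_one]
      linarith
  have hlim : Tendsto (fun b : ℝ => ((M + 1 + b * Real.log ‖z‖ : ℝ) : EReal))
      (nhdsWithin σ (Set.Ioi σ)) (nhds ((M + 1 + σ * Real.log ‖z‖ : ℝ) : EReal)) := by
    apply Tendsto.mono_left _ nhdsWithin_le_nhds
    apply Continuous.tendsto
    exact continuous_coe_real_ereal.comp (by fun_prop)
  exact ge_of_tendsto hlim (eventually_nhdsWithin_of_forall key)

/-- If `u < (σ - δ) log S` held on whole circles of arbitrarily large radius, the three circles
theorem would extend this, up to the constant `A`, to all of `|z| ≥ 1`, and the type would be at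
most `σ - δ`. -/
theorem exists_le_on_circles (hu : IsSubharmonic u) {σ δ A : ℝ} (hδ : 0 < δ)
    (h : logType u = σ) (hA : 0 < A) (hin : ∀ z, ‖z‖ ≤ 1 → u z < A) :
    ∃ R₀ : ℝ, 1 ≤ R₀ ∧ ∀ S, R₀ ≤ S →
      ∃ ζ : ℂ, ‖ζ‖ = S ∧ (((σ - δ) * Real.log S : ℝ) : EReal) ≤ u ζ := by
  by_contra! hcon
  have hle : logType u ≤ ((σ - δ : ℝ) : EReal) := by
    refine logType_le_of_le (C := A) (R := 1) fun z hz => ?_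
    obtain ⟨S, hS, hS'⟩ := hcon ‖z‖ hz
    have := hu.three_circles (z₀ := 0) (ρ := 1) (S := S) (a := A) (b := σ - δ) one_pos
      (fun x hx => hin x (by simpa using hx.le)) (fun x hx => ?_) (z := z) (by simpa using hz)
      (by simpa using hS)
    · simpa using this
    · rw [sub_zero] at hx
      refine (hS' x hx).trans (EReal.coe_lt_coe_iff.2 ?_)
      rw [div_one]
      linarith
  rw [h, EReal.coe_le_coe_iff] at hle
  linarith

/-! ### Integrability above the threshold and conclusion. -/

theorem isL2AtInfty_expNegMul (hu : IsSubharmonic u) {σ c : ℝ} (hσ : 0 < σ)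
    (h : logType u = σ) (hc : 1 / σ < c) : IsL2AtInfty (expNegMul c u) := by
  have hc0 : 0 < c := (one_div_pos.2 hσ).trans hc
  rw [div_lt_iff₀ hσ] at hc
  obtain ⟨A, hA, hin, hup⟩ := hu.exists_le_add_mul_posLog hσ.le h
  -- Here `t = 2c`. The first bound gives `t · 77δ ≤ 1`; the second makes `25tδ` at most half of `tσ
  -- - 2 > 0`.
  set δ : ℝ := min (1 / (77 * (2 * c))) ((2 * c * σ - 2) / (50 * (2 * c))) with hδdef
  have hδ : 0 < δ := lt_min (by positivity) (div_pos (by linarith) (by positivity))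
  have hδ1 : 2 * c * (77 * δ) ≤ 1 := by
    have : δ ≤ 1 / (77 * (2 * c)) := min_le_left _ _
    rw [le_div_iff₀ (by positivity)] at this
    linarith
  have hδ2 : 2 < 2 * c * (σ - 25 * δ) := by
    have : δ ≤ (2 * c * σ - 2) / (50 * (2 * c)) := min_le_right _ _
    rw [le_div_iff₀ (by positivity)] at this
    linarith
  obtain ⟨R₀, hR₀, hlow⟩ := hu.exists_le_on_circles hδ h hA hin
  have h2 : 0 ≤ σ * Real.log 2 := mul_nonneg hσ.le (Real.log_nonneg (by norm_num))
  obtain ⟨R, K, hK, H⟩ := exists_uniform_lintegral_exp_le_of_subMean (A := A + σ * Real.log 2)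
    (by positivity) hσ.le hδ hR₀ (by positivity) hδ1 hδ2
  -- The extra `σ log 2` comes from `log⁺(|z| + 1) ≤ log⁺|z| + log 2`, as the tent radius is at most
  -- `1`. The lower bound persists because the average dominates `u`.
  have hg : ∀ n : ℕ, HasLogGrowth (A + σ * Real.log 2) σ δ R₀
      (tentMollify (1 / ((n : ℝ) + 1)) u) := by
    intro n
    have hn : 0 < 1 / ((n : ℝ) + 1) := by positivity
    have hn1 : 1 / ((n : ℝ) + 1) ≤ 1 := by
      rw [div_le_one (by positivity)]
      have : (0 : ℝ) ≤ n := by positivity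
      linarith
    refine ⟨fun z => hu.tentMollify_le hn fun x hx => (hup x).trans (EReal.coe_le_coe_iff.2 ?_),
      fun S hS => ?_⟩
    · have hx1 : ‖x‖ ≤ ‖z‖ + 1 := by
        have h3 := norm_add_le (x - z) z
        rw [sub_add_cancel] at h3
        rw [mem_ball_iff_norm] at hx
        linarith
      have h4 := (Real.posLog_le_posLog (norm_nonneg _) hx1).trans Real.posLog_add
      rw [Real.posLog_one, add_zero] at h4
      have := mul_le_mul_of_nonneg_left h4 hσ.le
      linarith
    · obtain ⟨ζ, hζ, hle⟩ := hlow S hS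
      refine ⟨ζ, hζ, ?_⟩
      have := EReal.coe_le_coe_iff.1 (hle.trans (hu.le_tentMollify hn ζ))
      linarith
  refine ⟨(measurable_expNegMul hu.measurable).aemeasurable, Metric.closedBall 0 R,
    isCompact_closedBall 0 R, lt_of_le_of_lt ?_ hK⟩
  have hsub : (Metric.closedBall (0 : ℂ) R)ᶜ ⊆ {z : ℂ | R ≤ ‖z‖} := fun z hz => by
    have : ¬ ‖z‖ ≤ R := by simpa using hz
    exact (not_le.1 this).le
  calc ∫⁻ z in (Metric.closedBall 0 R)ᶜ, expNegMul c u z ^ 2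
      ≤ ∫⁻ z in {z : ℂ | R ≤ ‖z‖}, expNegMul c u z ^ 2 := lintegral_mono_set hsub
    _ ≤ ∫⁻ z in {z : ℂ | R ≤ ‖z‖}, liminf (fun n : ℕ => ENNReal.ofReal
          (Real.exp (-(2 * c * tentMollify (1 / ((n : ℝ) + 1)) u z)))) atTop := by
        refine lintegral_mono fun z => expNegMul_sq_le hc0 (fun b hb => ?_) (hu.lt_top z).ne
        refine le_liminf_of_le (by isBoundedDefault) ?_
        filter_upwards [hu.eventually_tentMollify_le hb] with n hn
        refine ENNReal.ofReal_le_ofReal (Real.exp_le_exp.2 (neg_le_neg ?_))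
        exact mul_le_mul_of_nonneg_left hn (by positivity)
    _ ≤ liminf (fun n : ℕ => ∫⁻ z in {z : ℂ | R ≤ ‖z‖}, ENNReal.ofReal
          (Real.exp (-(2 * c * tentMollify (1 / ((n : ℝ) + 1)) u z)))) atTop := by
        refine lintegral_liminf_le fun n => ?_
        have := (hu.continuous_tentMollify (1 / ((n : ℝ) + 1))).measurable
        fun_prop
    _ ≤ K := by
        refine (liminf_le_liminf (Eventually.of_forall fun n =>
          H _ (hu.continuous_tentMollify _) (hu.subMean_tentMollify (by positivity))
            (hg n))).trans_eq (liminf_const K)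

end IsSubharmonic

theorem sInf_ofReal_image_Ioi {x : ℝ} (hx : 0 ≤ x) :
    sInf (ENNReal.ofReal '' Set.Ioi x) = ENNReal.ofReal x := by
  refine le_antisymm (le_of_forall_gt fun y hy => ?_) (le_sInf ?_)
  · obtain ⟨r, hr, hxr, hry⟩ := ENNReal.lt_iff_exists_real_btwn.1 hy
    exact (sInf_le (Set.mem_image_of_mem _
      ((ENNReal.ofReal_lt_ofReal_iff_of_nonneg hx).1 hxr))).trans_lt hry
  · rintro _ ⟨r, hr, rfl⟩
    exact ENNReal.ofReal_le_ofReal (le_of_lt hr)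

theorem IsL2AtInfty.positivePart {c : ℝ} (hc : 0 ≤ c) {u : ℂ → EReal} (hu : Measurable u)
    (h : IsL2AtInfty (expNegMul c u)) : IsL2AtInfty (expNegMul c (positivePart u)) := by
  obtain ⟨-, K, hK, hfin⟩ := h
  refine ⟨(measurable_expNegMul (hu.max measurable_const)).aemeasurable, K, hK,
    lt_of_le_of_lt (lintegral_mono fun z => ?_) hfin⟩
  exact pow_le_pow_left₀ zero_le (expNegMul_antitone hc (le_max_left _ _)) 2

/-- A cycle of inclusions: `u ≤ u⁺` enlarges the set, the upper growth bound, which `u⁺` shares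
because `A > 0`, confines it to the half-line, and the annulus estimate returns to the set of `u`.
-/
theorem IsSubharmonic.integrabilitySet_eq {u : ℂ → EReal} (hu : IsSubharmonic u) {σ : ℝ}
    (hσ : 0 < σ) (h : logType u = σ) :
    integrabilitySet u = Set.Ioi (1 / σ) ∧
      integrabilitySet (positivePart u) = Set.Ioi (1 / σ) := by
  obtain ⟨A, hA, -, hup⟩ := hu.exists_le_add_mul_posLog hσ.le h
  have h1 : integrabilitySet u ⊆ integrabilitySet (positivePart u) := fun c hc =>
    ⟨hc.1, hc.2.positivePart hc.1.le hu.measurable⟩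
  have h2 : integrabilitySet (positivePart u) ⊆ Set.Ioi (1 / σ) := by
    rintro c ⟨hc, hL⟩
    by_contra hle
    rw [Set.mem_Ioi, not_lt, le_div_iff₀ hσ] at hle
    refine not_isL2AtInfty_expNegMul hc.le hle (A := A) (fun z hz => ?_) hL
    have h3 := hup z
    rw [Real.posLog_eq_log (by simpa using hz)] at h3
    refine max_le h3 ?_
    have := mul_nonneg hσ.le (Real.log_nonneg hz)
    exact_mod_cast add_nonneg hA.le this
  have h3 : Set.Ioi (1 / σ) ⊆ integrabilitySet u := fun c hc =>
    ⟨(one_div_pos.2 hσ).trans hc, hu.isL2AtInfty_expNegMul hσ h hc⟩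
  exact ⟨(h1.trans h2).antisymm h3, h2.antisymm (h3.trans h1)⟩

theorem integrabilitySet_const (a : ℝ) : integrabilitySet (fun _ => (a : EReal)) = ∅ := by
  refine Set.eq_empty_of_forall_notMem fun c hc => ?_
  exact not_isL2AtInfty_expNegMul hc.1.le (s := 0) (A := a) (by simp) (fun z _ => by simp) hc.2

theorem theorem4p1 (u : ℂ → EReal) (hu : IsLogSubharmonic u) :
    (0 ≤ logType u ∧
      lctAtInfty u = (logType u).toENNReal⁻¹ ∧
      lctHatAtInfty u = (logType u).toENNReal⁻¹) ∧
    ((¬ ∃ a : EReal, ∀ z, u z = a) →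
      0 < logType u ∧
      integrabilitySet u = Set.Ioi (1 / (logType u).toReal) ∧
      integrabilitySet (positivePart u) = Set.Ioi (1 / (logType u).toReal)) := by
  have hs := hu.isSubharmonic
  -- Nonpositive type means constant, hence type `0` and empty integrability sets; the infimum `⊤`
  -- agrees with `0⁻¹` in `ℝ≥0∞`.
  rcases le_or_gt (logType u) 0 with h0 | h0
  · have hc : ∀ z, u z = u 0 := fun z =>
      le_antisymm (hs.le_of_logType_nonpos h0 z 0) (hs.le_of_logType_nonpos h0 0 z)
    refine ⟨?_, fun hne => absurd ⟨u 0, hc⟩ hne⟩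
    obtain ⟨z₁, hz₁⟩ := hs.ne_bot
    rw [hc] at hz₁
    obtain ⟨a, rfl⟩ : ∃ a : ℝ, u = fun _ => (a : EReal) :=
      ⟨(u 0).toReal, funext fun z => by rw [hc, EReal.coe_toReal (hs.lt_top 0).ne hz₁]⟩
    have hp : positivePart (fun _ => (a : EReal)) = fun _ => ((max a 0 : ℝ) : EReal) := by
      ext z
      simp only [positivePart, ← EReal.coe_zero]
      exact (EReal.coe_strictMono.monotone.map_max).symm
    rw [lctHatAtInfty, lctAtInfty, lctAtInfty, hp, integrabilitySet_const, integrabilitySet_const,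
      logType_const]
    simp
  · obtain ⟨σ, hσ⟩ : ∃ σ : ℝ, logType u = σ :=
      ⟨(logType u).toReal, (EReal.coe_toReal hu.logType_lt_top.ne ((EReal.bot_lt_zero).trans h0).ne').symm⟩
    have hσ0 : 0 < σ := by rw [hσ] at h0; exact_mod_cast h0
    obtain ⟨e1, e2⟩ := hs.integrabilitySet_eq hσ0 hσ
    have e3 : (logType u).toENNReal⁻¹ = ENNReal.ofReal (1 / σ) := by
      rw [hσ, EReal.toENNReal_of_ne_top (EReal.coe_ne_top _), EReal.toReal_coe, one_div,
        ENNReal.ofReal_inv_of_pos hσ0]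
    refine ⟨⟨h0.le, ?_, ?_⟩, fun _ => ⟨h0, ?_, ?_⟩⟩
    · rw [lctAtInfty, e1, e3, sInf_ofReal_image_Ioi (by positivity)]
    · rw [lctHatAtInfty, lctAtInfty, e2, e3, sInf_ofReal_image_Ioi (by positivity)]
    · rw [e1, hσ, EReal.toReal_coe]
    · rw [e2, hσ, EReal.toReal_coe]
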